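/- A \emph{map} is a rooted non-separable planar map (no loops, no cut vertices), considered up to orientation-preserving homeomorphism; the root is a directed edge, the root-face lies to its right and is the outer face. A $\beta(1,0)$-tree is a rooted plane tree labelled with positive integers such that leaves have label $1$, the root (if it is not a leaf) has label equal to the sum of its children's labels, and every other non-leaf node has label at most the sum of its children's labels. To each $\beta(1,0)$-tree corresponds a map, built recursively. To every node one associates a rooted map with a starred vertex. A leaf gives the single edge directed from its root vertex to its starred vertex. For a node with label $i$ whose children have, from left to right, the maps $M_1,\dots,M_m$, glue the star vertex of $M_j$ to the root vertex of $M_{j+1}$ for $1\le j<m$, add in the outer face a new root edge directed from the star vertex of $M_m$ to the root vertex of $M_1$, and star the $i$-th vertex after the new root vertex counterclockwise along the outer face. The map of the tree is the map obtained at its root, without the star. \textbf{Lemma.} If every node other than the root of a $\beta(1,0)$-tree has a sibling, then the corresponding map (a rooted non-separable planar map with as many edges as the tree has nodes) has no multiple edges. \textbf{Lower bounds.} For $k=1,2$ let $B_k(x)=\sum_n b_k(n)x^n$, where $b_k(n)$ is the number of $\beta(1,0)$-trees with $n$ nodes in which every node other than the root has a sibling and all labels, except possibly that of the root, are at most $k$.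 Then for every $n\ge 0$ the number of multiple-edge-free maps with $n$ edges is at least $b_1(n)$ and at least $b_2(n)$ (a rooted map has at least one edge, so for $n=0$ all these numbers are $0$). Moreover \[ B_1(x)=\frac{1+x-\sqrt{1-2x-3x^2}}{2(1+x)},\qquad b_1(n)=\frac18\sqrt{\frac{3}{\pi n^3}}\,3^n+O\left(3^n n^{-2}\right), \] and \[ B_2=x+B_2(B_2-x)+(B_2-x)(B_2-x)+x\bigl(B_2+(B_2-x)\bigr)^2,\qquad B_2(x)=\frac{1+3x+4x^2-\sqrt{1-2x-7x^2}}{4+8x}, \] \[ b_2(n)=\frac{1}{8\sqrt2+12}\sqrt{\frac{4+\sqrt2}{\pi n^3}}\left(\frac{7}{2\sqrt2-1}\right)^n+O\left(\left(\frac{7}{2\sqrt2-1}\right)^n n^{-2}\right), \] where the square roots of polynomials are the formal power series with constant term $1$. -/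

import Mathlib

/-! ### Labelled plane trees and β(1,0)-trees -/

/-- Rooted plane trees whose nodes carry natural number labels; the children of a node are listed
from left to right. -/
inductive LabelledTree : Type
  | node (label : ℕ) (children : List LabelledTree) : LabelledTree

namespace LabelledTree

/-- The label of the root. -/
def label : LabelledTree → ℕ
  | node l _ => l

/-- The subtrees hanging from the root, from left to right. -/
def children : LabelledTree → List LabelledTree
  | node _ cs => cs

mutual
/-- The nodes of a tree in preorder; a node is represented by the subtree rooted at it, and the
list has one entry for each node (so equal subtrees at different places are repeated). -/
def nodes : LabelledTree → List LabelledTree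
  | node l cs => node l cs :: nodesOfForest cs
/-- The nodes of all the trees in a list. -/
def nodesOfForest : List LabelledTree → List LabelledTree
  | [] => []
  | t :: ts => nodes t ++ nodesOfForest ts
end

/-- The nodes other than the root. -/
def nonRootNodes (t : LabelledTree) : List LabelledTree := nodesOfForest t.children

/-- The number of nodes. -/
def numNodes (t : LabelledTree) : ℕ := t.nodes.length

/-- The sum of the labels of the children of the root. -/
def childSum (t : LabelledTree) : ℕ := (t.children.map label).sum

/-- β(1,0)-trees: labels are positive, leaves have label `1`, the label of the root is the sum of
its children's labels, and the label of any other node that is not a leaf is at most the sum of its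
children's labels. (The tree with a single node is a leaf, so it has label `1`.) -/
structure IsBeta10 (t : LabelledTree) : Prop where
  label_pos : ∀ s ∈ t.nodes, 0 < s.label
  label_leaf : ∀ s ∈ t.nodes, s.children = [] → s.label = 1
  label_root : t.children ≠ [] → t.label = t.childSum
  label_le : ∀ s ∈ t.nonRootNodes, s.children ≠ [] → s.label ≤ s.childSum

/-- Every node other than the root has a sibling: whenever a node `s` of the tree has an `i`-th
child, it also has a `j`-th child for some `j ≠ i`. -/
def EveryNonRootHasSibling (t : LabelledTree) : Prop :=
  ∀ s ∈ t.nodes, ∀ i : Fin s.children.length, ∃ j : Fin s.children.length, j ≠ i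

/-- All labels, except possibly that of the root, are at most `k`. -/
def NonRootLabelsLE (k : ℕ) (t : LabelledTree) : Prop :=
  ∀ s ∈ t.nonRootNodes, s.label ≤ k

/-- The number of β(1,0)-trees with `n` nodes in which every node other than the root has a sibling
and all labels, except possibly that of the root, are at most `k`. -/
noncomputable def numSiblingTrees (k n : ℕ) : ℕ :=
  Nat.card {t : LabelledTree //
    t.IsBeta10 ∧ t.EveryNonRootHasSibling ∧ t.NonRootLabelsLE k ∧ t.numNodes = n}

/-- The generating function, by number of nodes, of the trees counted by `numSiblingTrees k`. -/
noncomputable def siblingTreeGF (k : ℕ) : PowerSeries ℝ :=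
  PowerSeries.mk fun n => (numSiblingTrees k n : ℝ)

end LabelledTree

/-! ### Rooted maps -/

/-- A rooted map on an oriented surface, given by its darts (directed edges). `rot` sends a dart to
the next dart counterclockwise around its origin, `rev` reverses a dart. -/
structure RootedMap where
  Dart : Type
  [fintype : Fintype Dart]
  [decEq : DecidableEq Dart]
  rot : Equiv.Perm Dart
  rev : Equiv.Perm Dart
  rev_rev : ∀ d, rev (rev d) = d
  rev_ne : ∀ d, rev d ≠ d
  root : Dart

attribute [instance] RootedMap.fintype RootedMap.decEq

namespace RootedMap

/-- `M.next d` is the dart following `d` on the boundary of the face to the right of `d`. -/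
def next (M : RootedMap) : Equiv.Perm M.Dart := M.rot * M.rev

/-- Vertices are the cycles of `rot`. -/
def Vertex (M : RootedMap) : Type := Quotient (Equiv.Perm.SameCycle.setoid M.rot)

/-- Edges are the cycles of `rev`. -/
def Edge (M : RootedMap) : Type := Quotient (Equiv.Perm.SameCycle.setoid M.rev)

/-- Faces are the cycles of `next`. -/
def Face (M : RootedMap) : Type := Quotient (Equiv.Perm.SameCycle.setoid M.next)

/-- The origin of a dart. -/
def origin (M : RootedMap) (d : M.Dart) : M.Vertex := Quotient.mk _ d

/-- The edge underlying a dart. -/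
def edge (M : RootedMap) (d : M.Dart) : M.Edge := Quotient.mk _ d

/-- The number of edges. -/
noncomputable def numEdges (M : RootedMap) : ℕ := Nat.card M.Edge

/-- The edge `e` is incident with the vertex `v`. -/
def Incident (M : RootedMap) (e : M.Edge) (v : M.Vertex) : Prop :=
  ∃ d, M.edge d = e ∧ M.origin d = v

/-- The unordered pair of end vertices of the edge underlying a dart. -/
def ends (M : RootedMap) (d : M.Dart) : Sym2 M.Vertex := s(M.origin d, M.origin (M.rev d))

/-- The map is connected: `rot` and `rev` generate a transitive group on the darts. -/
def IsConnected (M : RootedMap) : Prop :=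
  ∀ d d' : M.Dart, ∃ g ∈ Subgroup.closure {M.rot, M.rev}, g d = d'

/-- Planarity: the map is connected and its surface is the sphere, by Euler's formula. -/
def IsPlanar (M : RootedMap) : Prop :=
  M.IsConnected ∧ Nat.card M.Vertex + Nat.card M.Face = Nat.card M.Edge + 2

/-- The map has no loops. -/
def IsLoopless (M : RootedMap) : Prop := ∀ d, M.origin d ≠ M.origin (M.rev d)

/-- `v` is a cut vertex: the edges can be partitioned into two nonempty sets such that `v` is the
unique vertex incident with edges of both sets. -/
def IsCutVertex (M : RootedMap) (v : M.Vertex) : Prop :=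
  ∃ S : Set M.Edge, S.Nonempty ∧ Sᶜ.Nonempty ∧
    ∀ w, ((∃ e ∈ S, M.Incident e w) ∧ (∃ e ∈ Sᶜ, M.Incident e w)) ↔ w = v

/-- Rooted non-separable planar maps. -/
def IsNonseparablePlanar (M : RootedMap) : Prop :=
  M.IsPlanar ∧ M.IsLoopless ∧ ∀ v, ¬ M.IsCutVertex v

/-- No two distinct edges have the same end vertices. -/
def IsMultipleEdgeFree (M : RootedMap) : Prop :=
  ∀ d d' : M.Dart, M.ends d = M.ends d' → M.edge d = M.edge d'

/-- Isomorphism of rooted maps, that is, orientation-preserving homeomorphism respecting roots. -/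
def Iso (M N : RootedMap) : Prop :=
  ∃ f : M.Dart ≃ N.Dart, (∀ d, f (M.rot d) = N.rot (f d)) ∧ (∀ d, f (M.rev d) = N.rev (f d)) ∧
    f M.root = N.root

/-- Isomorphism is an equivalence relation. -/
def isoSetoid : Setoid RootedMap where
  r := Iso
  iseqv :=
    { refl := fun M => ⟨Equiv.refl _, fun _ => rfl, fun _ => rfl, rfl⟩
      symm := by
        rintro M N ⟨f, h₁, h₂, h₃⟩
        refine ⟨f.symm, fun d => ?_, fun d => ?_, ?_⟩
        · rw [Equiv.symm_apply_eq, h₁, Equiv.apply_symm_apply]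
        · rw [Equiv.symm_apply_eq, h₂, Equiv.apply_symm_apply]
        · rw [Equiv.symm_apply_eq, h₃]
      trans := by
        rintro M N P ⟨f, h₁, h₂, h₃⟩ ⟨g, k₁, k₂, k₃⟩
        exact ⟨f.trans g, fun d => by simp [h₁, k₁], fun d => by simp [h₂, k₂],
          by simp [h₃, k₃]⟩ }

/-- The number of multiple-edge-free rooted non-separable planar maps with `n` edges, counted up
to isomorphism. -/
noncomputable def numMultipleEdgeFree (n : ℕ) : ℕ :=
  ((Quotient.mk isoSetoid) ''
    {M : RootedMap | M.IsNonseparablePlanar ∧ M.IsMultipleEdgeFree ∧ M.numEdges = n}).ncard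

end RootedMap

/-! ### The map corresponding to a tree -/

/-- A rooted map with a second distinguished dart. The root and star vertices are the origins of
`root` and `star`; moreover `root` and `star` select the corners just clockwise of them, which is
where the map is glued to other maps. -/
structure StarredMap extends RootedMap where
  star : Dart

namespace StarredMap

/-- A rooted map, starred at the `i`-th vertex after the root vertex in the counterclockwise
direction on the root face, which is the outer face. The root face lies to the right of the root,
so following its boundary by `next` is going counterclockwise around the map. -/
def mark (M : RootedMap) (i : ℕ) : StarredMap where
  toRootedMap := M
  star := (M.next ^ i) M.root

/-- The map with one edge, joining two vertices. -/
def link : RootedMap where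
  Dart := Bool
  rot := 1
  rev := Equiv.boolNot
  rev_rev := by decide
  rev_ne := by decide
  root := true

/-- Glue the star vertex of `M` to the root vertex of `N`, inside the outer face. The result has
the root of `M` and the star of `N`. -/
def glue (M N : StarredMap) : StarredMap where
  Dart := M.Dart ⊕ N.Dart
  rot := Equiv.swap (Sum.inl M.star) (Sum.inr N.root) * Equiv.sumCongr M.rot N.rot
  rev := Equiv.sumCongr M.rev N.rev
  rev_rev := by rintro (d | d) <;> simp [M.rev_rev, N.rev_rev]
  rev_ne := by rintro (d | d) <;> simp [M.rev_ne, N.rev_ne]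
  root := Sum.inl M.root
  star := Sum.inr N.star

/-- Glue a nonempty sequence of maps successively, from left to right. -/
def chain (M : StarredMap) : List StarredMap → StarredMap
  | [] => M
  | N :: Ns => M.glue (chain N Ns)

/-- Add, in the outer face, a new edge from the star vertex to the root vertex. This edge is the
new root, directed from the old star vertex to the old root vertex. The new darts are
`Sum.inl true`, the new root, and its reverse `Sum.inl false`. -/
def close (M : StarredMap) : RootedMap where
  Dart := Bool ⊕ M.Dart
  rot := Equiv.swap (Sum.inl true) (Sum.inr M.star) *
    (Equiv.swap (Sum.inl false) (Sum.inr M.root) * Equiv.sumCongr (Equiv.refl Bool) M.rot)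
  rev := Equiv.sumCongr Equiv.boolNot M.rev
  rev_rev := by rintro (d | d) <;> simp [M.rev_rev]
  rev_ne := by rintro (d | d) <;> simp [M.rev_ne]
  root := Sum.inl true

/-- The starred map of a node with label `i`, given the starred maps of its children. -/
def assemble (i : ℕ) : List StarredMap → StarredMap
  | [] => mark link i
  | M :: Ms => mark (M.chain Ms).close i

end StarredMap

namespace LabelledTree

mutual
/-- The starred map of the subtree at a node. -/
def toStarredMap : LabelledTree → StarredMap
  | node l cs => StarredMap.assemble l (toStarredMaps cs)
/-- The starred maps of a list of trees. -/
def toStarredMaps : List LabelledTree → List StarredMap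
  | [] => []
  | t :: ts => toStarredMap t :: toStarredMaps ts
end

/-- The rooted map corresponding to a β(1,0)-tree. -/
def toMap (t : LabelledTree) : RootedMap := t.toStarredMap.toRootedMap

end LabelledTree

-- Sufficient condition. By induction, every node carries a block: an inseparable map (a proper
-- nonempty set of edges shares at least two vertices with its complement) that is loopless, simple
-- and spherical, and whose star lies on the root face as many steps from the root as the label
-- says, through distinct vertices (`IsProper.isBlock`). Gluing blocks gives a chain that becomes
-- inseparable once its ends are joined by an edge. With at least two blocks the ends of the chain
-- lie in different blocks, away from the gluing vertices, so no edge joins them and the new root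
-- edge is parallel to nothing; this is where siblings are needed (`glue_not_adjacent`). Gluing and
-- closing multiply `rot` and `next` by transpositions, which merge or split cycles, so Euler's
-- formula is bookkeeping on numbers of cycles.
--
-- Lower bounds. The tree can be read off its map (`eq_of_iso`). Removing the root edge leaves the
-- chain; an inseparable piece cannot spread over both sides of a gluing vertex, so the chain splits
-- uniquely into blocks. The label of a child is the distance from root to star, and the label of
-- the root is determined by the children. Since there are finitely many maps with `n` edges, the
-- number of trees is a lower bound.
--
-- Generating functions. For `k ≤ 2` the bound of a label by the sum over the children is automatic,
-- because there are at least two children with positive labels. Hence the trees with all labels at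
-- most `k` satisfy `T = X + k X P`, where `P = T² / (1 - T)` counts forests of at least two trees,
-- while `B = X + X P` since the root label is forced. So `T = B` for `k = 1` and `T = 2B - X` for
-- `k = 2`, and both quadratics are solved by square roots with constant term 1.
--
-- Asymptotics. The discriminants factor as `(1 - αx)(1 - αyx)` with `|y| < 1`. After rescaling by
-- `α`, the coefficients are those of `√(1 - x)` convolved with a sequence decreasing geometrically.
-- The former are `-1 / (2n√(πn)) + O(n⁻²)` by Wallis's product, and the convolution multiplies them
-- by the value of the regular factor at 1 up to `O(n⁻²)` (`isBigO_coeff_of_sqrtSeries`).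

/-! ### Cycles of permutations multiplied by a transposition -/

namespace Equiv.Perm

variable {α β : Type*}

/-- The number of cycles, fixed points included. -/
noncomputable def numCycles (σ : Perm α) : ℕ := Nat.card (Quotient (SameCycle.setoid σ))

/-- Lying on a common cycle is the smallest equivalence relation relating each point to its image;
used below as an induction principle. -/
theorem SameCycle.of_equivalence [Finite α] {σ : Perm α} {R : α → α → Prop} (hR : Equivalence R)
    (h : ∀ a, R a (σ a)) {a b : α} (hab : SameCycle σ a b) : R a b := by
  obtain ⟨n, rfl⟩ := hab.exists_nat_pow_eq
  clear hab
  induction n with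
  | zero => exact hR.refl a
  | succ n ih =>
    rw [pow_succ', mul_apply]
    exact hR.trans ih (h _)

theorem sameCycle_apply_self (σ : Perm α) (a : α) : SameCycle σ a (σ a) := ⟨1, by simp⟩

section Swap

variable [DecidableEq α]

/-- Along the `σ`-cycle of `x` the product agrees with `σ` until the cycle returns to `x`, since `y`
is never met; at that moment the product goes to `y` instead. -/
theorem sameCycle_swap_mul_self [Finite α] {σ : Perm α} {x y : α} (h : ¬ SameCycle σ x y) :
    SameCycle (swap x y * σ) x y := by
  by_contra hxy
  have key : ∀ n : ℕ, SameCycle (swap x y * σ) x ((σ ^ n) x) := by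
    intro n
    induction n with
    | zero => exact SameCycle.refl _ _
    | succ n ih =>
      have h1 := ih.trans (sameCycle_apply_self (swap x y * σ) _)
      have h2 : (σ ^ (n + 1)) x = σ ((σ ^ n) x) := by rw [pow_succ', mul_apply]
      rw [mul_apply, ← h2] at h1
      by_cases hx : (σ ^ (n + 1)) x = x
      · rw [hx, swap_apply_left] at h1
        exact absurd h1 hxy
      · by_cases hy : (σ ^ (n + 1)) x = y
        · exact absurd ⟨(n + 1 : ℕ), by rwa [zpow_natCast]⟩ h
        · rwa [swap_apply_of_ne_of_ne hx hy] at h1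
  obtain ⟨n, hn, -, h0⟩ := (SameCycle.refl σ x).exists_pow_eq''
  obtain ⟨m, rfl⟩ := Nat.exists_eq_succ_of_ne_zero hn.ne'
  have h1 := (key m).trans (sameCycle_apply_self (swap x y * σ) _)
  rw [mul_apply, ← mul_apply σ, ← pow_succ', h0, swap_apply_left] at h1
  exact hxy h1

theorem sameCycle_swap_mul [Finite α] {σ : Perm α} {x y : α} (h : ¬ SameCycle σ x y) {a b : α} :
    SameCycle (swap x y * σ) a b ↔ SameCycle σ a b ∨ (SameCycle σ a x ∧ SameCycle σ b y) ∨
      (SameCycle σ a y ∧ SameCycle σ b x) := by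
  have hxy := sameCycle_swap_mul_self h
  have lift : ∀ {a b : α}, SameCycle σ a b → SameCycle (swap x y * σ) a b := by
    intro a b
    refine SameCycle.of_equivalence (SameCycle.equivalence _) fun c => ?_
    have h1 := sameCycle_apply_self (swap x y * σ) c
    rw [mul_apply] at h1
    by_cases hx : σ c = x
    · rw [hx, swap_apply_left] at h1
      exact hx ▸ h1.trans hxy.symm
    · by_cases hy : σ c = y
      · rw [hy, swap_apply_right] at h1
        exact hy ▸ h1.trans hxy
      · rwa [swap_apply_of_ne_of_ne hx hy] at h1
  constructor
  · refine SameCycle.of_equivalence (R := fun a b => SameCycle σ a b ∨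
      (SameCycle σ a x ∧ SameCycle σ b y) ∨ (SameCycle σ a y ∧ SameCycle σ b x))
      ⟨fun a => Or.inl (SameCycle.refl _ _), ?_, ?_⟩ fun c => ?_
    · rintro a b (h1 | ⟨h1, h2⟩ | ⟨h1, h2⟩)
      · exact Or.inl h1.symm
      · exact Or.inr (Or.inr ⟨h2, h1⟩)
      · exact Or.inr (Or.inl ⟨h2, h1⟩)
    · rintro a b c (h1 | ⟨h1, h2⟩ | ⟨h1, h2⟩) (h3 | ⟨h3, h4⟩ | ⟨h3, h4⟩)
      · exact Or.inl (h1.trans h3)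
      · exact Or.inr (Or.inl ⟨h1.trans h3, h4⟩)
      · exact Or.inr (Or.inr ⟨h1.trans h3, h4⟩)
      · exact Or.inr (Or.inl ⟨h1, h3.symm.trans h2⟩)
      · exact absurd (h3.symm.trans h2) h
      · exact Or.inl (h1.trans h4.symm)
      · exact Or.inr (Or.inr ⟨h1, h3.symm.trans h2⟩)
      · exact Or.inl (h1.trans h4.symm)
      · exact absurd (h2.symm.trans h3) h
    · have h1 := sameCycle_apply_self σ c
      rw [mul_apply]
      by_cases hx : σ c = x
      · rw [hx, swap_apply_left]
        exact Or.inr (Or.inl ⟨hx ▸ h1, SameCycle.refl _ _⟩)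
      · by_cases hy : σ c = y
        · rw [hy, swap_apply_right]
          exact Or.inr (Or.inr ⟨hy ▸ h1, SameCycle.refl _ _⟩)
        · rw [swap_apply_of_ne_of_ne hx hy]
          exact Or.inl h1
  · rintro (h1 | ⟨h1, h2⟩ | ⟨h1, h2⟩)
    · exact lift h1
    · exact ((lift h1).trans hxy).trans (lift h2).symm
    · exact ((lift h1).trans hxy.symm).trans (lift h2).symm

/-- Only the cycles of `x` and `y` merge, so the cycles of `σ` other than that of `y` correspond to
the cycles of the product. -/
theorem numCycles_swap_mul [Finite α] {σ : Perm α} {x y : α} (h : ¬ SameCycle σ x y) :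
    numCycles (swap x y * σ) + 1 = numCycles σ := by
  classical
  let Q := Quotient (SameCycle.setoid σ)
  let y' : Q := Quotient.mk _ y
  let g : Q → Quotient (SameCycle.setoid (swap x y * σ)) :=
    Quotient.map' id fun a b (hab : SameCycle σ a b) => (sameCycle_swap_mul h).2 (Or.inl hab)
  have hb : Function.Bijective fun q : {q : Q // q ≠ y'} => g q.1 := by
    constructor
    · rintro ⟨⟨a⟩, ha⟩ ⟨⟨b⟩, hb⟩ hab
      have ha' : ¬ SameCycle σ a y := fun h' => ha (Quotient.sound h')
      have hb' : ¬ SameCycle σ b y := fun h' => hb (Quotient.sound h')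
      have hab' : SameCycle (swap x y * σ) a b := Quotient.exact hab
      rw [sameCycle_swap_mul h] at hab'
      exact Subtype.ext (Quotient.sound (by tauto))
    · rintro ⟨a⟩
      by_cases ha : SameCycle σ a y
      · refine ⟨⟨Quotient.mk _ x, fun h' => h (Quotient.exact h')⟩, Quotient.sound ?_⟩
        exact (sameCycle_swap_mul h).2 (Or.inr (Or.inl ⟨SameCycle.refl _ _, ha⟩))
      · exact ⟨⟨Quotient.mk _ a, fun h' => ha (Quotient.exact h')⟩, rfl⟩
  have h1 := Nat.card_eq_of_bijective _ hb
  have : Finite Q := Quotient.finite _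
  have h2 : Nat.card {q : Q // q ≠ y'} + 1 = Nat.card Q := by
    have := Fintype.ofFinite Q
    rw [Nat.card_eq_fintype_card, Nat.card_eq_fintype_card, Fintype.card_subtype_compl,
      Fintype.card_subtype_eq]
    have : 0 < Fintype.card Q := Fintype.card_pos_iff.2 ⟨y'⟩
    omega
  unfold numCycles
  rw [← h1, h2]

theorem numCycles_swap_mul_of_not_sameCycle [Finite α] {σ : Perm α} {x y : α}
    (h : ¬ SameCycle (swap x y * σ) x y) : numCycles (swap x y * σ) = numCycles σ + 1 := by
  rw [← numCycles_swap_mul h, ← mul_assoc, swap_mul_self, one_mul]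

end Swap

theorem sumCongr_zpow_apply_inl (σ : Perm α) (τ : Perm β) (i : ℤ) (a : α) :
    (Perm.sumCongr σ τ ^ i) (Sum.inl a) = Sum.inl ((σ ^ i) a) := by
  have := map_zpow (sumCongrHom α β) (σ, τ) i
  simp only [sumCongrHom_apply] at this
  rw [← this]
  rfl

theorem sumCongr_zpow_apply_inr (σ : Perm α) (τ : Perm β) (i : ℤ) (b : β) :
    (Perm.sumCongr σ τ ^ i) (Sum.inr b) = Sum.inr ((τ ^ i) b) := by
  have := map_zpow (sumCongrHom α β) (σ, τ) i
  simp only [sumCongrHom_apply] at this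
  rw [← this]
  rfl

@[simp] theorem sameCycle_sumCongr_inl_inl {σ : Perm α} {τ : Perm β} {a b : α} :
    SameCycle (Equiv.sumCongr σ τ) (Sum.inl a) (Sum.inl b) ↔ SameCycle σ a b :=
  exists_congr fun i => by
    rw [show (Equiv.sumCongr σ τ : Perm (α ⊕ β)) = Perm.sumCongr σ τ from rfl,
      sumCongr_zpow_apply_inl, Sum.inl.injEq]

@[simp] theorem sameCycle_sumCongr_inr_inr {σ : Perm α} {τ : Perm β} {a b : β} :
    SameCycle (Equiv.sumCongr σ τ) (Sum.inr a) (Sum.inr b) ↔ SameCycle τ a b :=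
  exists_congr fun i => by
    rw [show (Equiv.sumCongr σ τ : Perm (α ⊕ β)) = Perm.sumCongr σ τ from rfl,
      sumCongr_zpow_apply_inr, Sum.inr.injEq]

@[simp] theorem not_sameCycle_sumCongr_inl_inr {σ : Perm α} {τ : Perm β} {a : α} {b : β} :
    ¬ SameCycle (Equiv.sumCongr σ τ) (Sum.inl a) (Sum.inr b) := by
  rintro ⟨i, hi⟩
  rw [show (Equiv.sumCongr σ τ : Perm (α ⊕ β)) = Perm.sumCongr σ τ from rfl,
    sumCongr_zpow_apply_inl] at hi
  cases hi

@[simp] theorem not_sameCycle_sumCongr_inr_inl {σ : Perm α} {τ : Perm β} {a : α} {b : β} :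
    ¬ SameCycle (Equiv.sumCongr σ τ) (Sum.inr b) (Sum.inl a) :=
  fun h => not_sameCycle_sumCongr_inl_inr h.symm

theorem numCycles_sumCongr [Finite α] [Finite β] (σ : Perm α) (τ : Perm β) :
    numCycles (Equiv.sumCongr σ τ) = numCycles σ + numCycles τ := by
  have : Finite (Quotient (SameCycle.setoid σ)) := Quotient.finite _
  have : Finite (Quotient (SameCycle.setoid τ)) := Quotient.finite _
  unfold numCycles
  rw [← Nat.card_sum]
  symm
  let f : Quotient (SameCycle.setoid σ) ⊕ Quotient (SameCycle.setoid τ) →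
      Quotient (SameCycle.setoid (Equiv.sumCongr σ τ : Perm (α ⊕ β))) :=
    Sum.elim (Quotient.map' Sum.inl fun a b h => sameCycle_sumCongr_inl_inl.2 h)
      (Quotient.map' Sum.inr fun a b h => sameCycle_sumCongr_inr_inr.2 h)
  refine Nat.card_eq_of_bijective f ⟨?_, ?_⟩
  · have key : ∀ u v : α ⊕ β, (Quotient.mk _ u : Quotient (SameCycle.setoid
        (Equiv.sumCongr σ τ : Perm (α ⊕ β)))) = Quotient.mk _ v → SameCycle _ u v :=
      fun u v => Quotient.exact
    rintro (a | a) (b | b) hab <;> induction a using Quotient.inductionOn with | _ a <;>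
      induction b using Quotient.inductionOn with | _ b
    · exact congrArg Sum.inl (Quotient.sound' (sameCycle_sumCongr_inl_inl.1 (key _ _ hab)))
    · exact absurd (key _ _ hab) not_sameCycle_sumCongr_inl_inr
    · exact absurd (key _ _ hab) not_sameCycle_sumCongr_inr_inl
    · exact congrArg Sum.inr (Quotient.sound' (sameCycle_sumCongr_inr_inr.1 (key _ _ hab)))
  · rintro ⟨a | b⟩
    · exact ⟨Sum.inl (Quotient.mk _ a), rfl⟩
    · exact ⟨Sum.inr (Quotient.mk _ b), rfl⟩

theorem sumCongr_mul_sumCongr (σ σ' : Perm α) (τ τ' : Perm β) :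
    (Equiv.sumCongr σ τ : Perm (α ⊕ β)) * Equiv.sumCongr σ' τ' =
      Equiv.sumCongr (σ * σ') (τ * τ') := by
  ext (a | b) <;> rfl

theorem numCycles_boolNot : numCycles Equiv.boolNot = 1 := by
  refine Nat.card_eq_one_iff_unique.2 ⟨⟨?_⟩, ⟨Quotient.mk _ true⟩⟩
  have h : ∀ a b, SameCycle Equiv.boolNot a b := by
    intro a b
    by_cases hab : a = b
    · exact ⟨0, hab⟩
    · exact ⟨1, by cases a <;> cases b <;> simp_all⟩
  rintro ⟨a⟩ ⟨b⟩
  exact Quotient.sound (h a b)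

theorem numCycles_one : numCycles (1 : Perm α) = Nat.card α := by
  refine (Nat.card_eq_of_bijective (fun a : α => (Quotient.mk _ a : Quotient (SameCycle.setoid 1)))
    ⟨fun a b h => ?_, fun q => ?_⟩).symm
  · exact sameCycle_one.1 (Quotient.exact h)
  · obtain ⟨a⟩ := q
    exact ⟨a, rfl⟩

end Equiv.Perm

/-! ### Vertices, arcs and separability of maps, in terms of darts -/

namespace RootedMap

variable (M : RootedMap)

theorem origin_eq_iff {a b : M.Dart} : M.origin a = M.origin b ↔ M.rot.SameCycle a b :=
  ⟨Quotient.exact (s := Equiv.Perm.SameCycle.setoid M.rot),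
    Quotient.sound (s := Equiv.Perm.SameCycle.setoid M.rot)⟩

theorem edge_eq_iff {a b : M.Dart} : M.edge a = M.edge b ↔ M.rev.SameCycle a b :=
  ⟨Quotient.exact (s := Equiv.Perm.SameCycle.setoid M.rev),
    Quotient.sound (s := Equiv.Perm.SameCycle.setoid M.rev)⟩

theorem edge_rev (d : M.Dart) : M.edge (M.rev d) = M.edge d :=
  (M.edge_eq_iff.2 (Equiv.Perm.sameCycle_apply_self M.rev d)).symm

theorem isLoopless_iff : M.IsLoopless ↔ ∀ d, ¬ M.rot.SameCycle d (M.rev d) :=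
  forall_congr' fun _ => not_congr M.origin_eq_iff

/-- The vertex of the dart `w` is incident with the dart set `A` and with its complement. -/
def Mixed (A : Set M.Dart) (w : M.Dart) : Prop :=
  (∃ a ∈ A, M.rot.SameCycle a w) ∧ ∃ b ∉ A, M.rot.SameCycle b w

/-- Every proper nonempty set of edges shares at least two vertices with its complement. -/
def IsInseparable : Prop :=
  ∀ A : Set M.Dart, (∀ d ∈ A, M.rev d ∈ A) → A.Nonempty → Aᶜ.Nonempty →
    ∃ w w', M.Mixed A w ∧ M.Mixed A w' ∧ ¬ M.rot.SameCycle w w'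

/-- No two distinct darts have the same origin and the same target. -/
def IsSimple : Prop :=
  ∀ d d', M.rot.SameCycle d d' → M.rot.SameCycle (M.rev d) (M.rev d') → d = d'

/-- Euler's formula for the sphere. -/
def IsSpherical : Prop := M.rot.numCycles + M.next.numCycles = M.rev.numCycles + 2

/-- The properties preserved by gluing maps at a vertex. -/
structure IsCactus : Prop where
  loopless : ∀ d, ¬ M.rot.SameCycle d (M.rev d)
  simple : M.IsSimple
  spherical : M.IsSpherical

variable {M}

theorem Mixed.compl {A : Set M.Dart} {w : M.Dart} (h : M.Mixed Aᶜ w) : M.Mixed A w := by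
  obtain ⟨⟨a, ha, ha'⟩, b, hb, hb'⟩ := h
  exact ⟨⟨b, not_not.1 hb, hb'⟩, a, ha, ha'⟩

theorem rev_mem_compl {A : Set M.Dart} (hA : ∀ d ∈ A, M.rev d ∈ A) : ∀ d ∈ Aᶜ, M.rev d ∈ Aᶜ :=
  fun d hd h => hd (by simpa [M.rev_rev] using hA _ h)

/-- If an orbit of the group generated by `rot` and `rev` were proper, it would share a vertex with
its complement, but orbits are unions of vertices. -/
theorem IsInseparable.isConnected (h : M.IsInseparable) : M.IsConnected := by
  intro d
  by_contra! hd
  obtain ⟨d', hd'⟩ := hd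
  let G := Subgroup.closure {M.rot, M.rev}
  have hrot : M.rot ∈ G := Subgroup.subset_closure (by simp)
  have hrev : M.rev ∈ G := Subgroup.subset_closure (by simp)
  obtain ⟨w, -, ⟨⟨a, ⟨g, hg, rfl⟩, i, hi⟩, b, hb, j, hj⟩, -⟩ :=
    h {x | ∃ g ∈ G, g d = x} (fun x ⟨g, hg, hx⟩ => ⟨M.rev * g, G.mul_mem hrev hg, by simp [hx]⟩)
      ⟨d, 1, G.one_mem, rfl⟩ ⟨d', fun ⟨g, hg, hx⟩ => hd' g hg hx⟩
  refine hb ⟨(M.rot ^ j)⁻¹ * (M.rot ^ i * g), G.mul_mem (G.inv_mem (G.zpow_mem hrot j))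
    (G.mul_mem (G.zpow_mem hrot i) hg), ?_⟩
  rw [Equiv.Perm.mul_apply, Equiv.Perm.mul_apply, hi, ← hj, ← Equiv.Perm.mul_apply, inv_mul_cancel,
    Equiv.Perm.one_apply]

theorem IsInseparable.not_isCutVertex (h : M.IsInseparable) (v : M.Vertex) :
    ¬ M.IsCutVertex v := by
  rintro ⟨S, ⟨⟨a⟩, ha⟩, ⟨⟨b⟩, hb⟩, hS⟩
  obtain ⟨w, w', hw, hw', hne⟩ := h {d | M.edge d ∈ S}
    (fun d hd => by rwa [Set.mem_ofPred_eq, edge_rev]) ⟨a, ha⟩ ⟨b, hb⟩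
  have key : ∀ w, M.Mixed {d | M.edge d ∈ S} w → M.origin w = v := by
    rintro w ⟨⟨a, ha, ha'⟩, b, hb, hb'⟩
    exact (hS _).1 ⟨⟨_, ha, a, rfl, M.origin_eq_iff.2 ha'⟩, _, hb, b, rfl, M.origin_eq_iff.2 hb'⟩
  exact hne (M.origin_eq_iff.1 ((key w hw).trans (key w' hw').symm))

theorem IsSimple.isMultipleEdgeFree (h : M.IsSimple) : M.IsMultipleEdgeFree := by
  intro d d' hd
  rw [ends, ends, Sym2.eq_iff] at hd
  simp only [origin_eq_iff] at hd
  obtain ⟨h1, h2⟩ | ⟨h1, h2⟩ := hd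
  · rw [h d d' h1 h2]
  · rw [h d (M.rev d') h1 (by rwa [M.rev_rev]), edge_rev]

theorem IsInseparable.isNonseparablePlanar (h : M.IsInseparable) (h' : M.IsCactus) :
    M.IsNonseparablePlanar :=
  ⟨⟨h.isConnected, h'.spherical⟩, M.isLoopless_iff.2 h'.loopless, h.not_isCutVertex⟩

end RootedMap

namespace StarredMap

open Equiv Equiv.Perm

/-- The star is reached from the root after `L` steps along the root face, through distinct
vertices. -/
structure HasArc (M : StarredMap) (L : ℕ) : Prop where
  star_eq : M.star = (M.next ^ L) M.root
  injOn : ∀ j ≤ L, ∀ k ≤ L, M.rot.SameCycle ((M.next ^ j) M.root) ((M.next ^ k) M.root) → j = k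

/-- The vertex of `w` belongs to an edge of `A`, and either to an edge outside `A` or to the
root or the star. -/
def OuterMixed (M : StarredMap) (A : Set M.Dart) (w : M.Dart) : Prop :=
  (∃ a ∈ A, M.rot.SameCycle a w) ∧
    ((∃ b ∉ A, M.rot.SameCycle b w) ∨ M.rot.SameCycle M.root w ∨ M.rot.SameCycle M.star w)

/-- Adding an edge between the root and the star gives an inseparable map. -/
def IsLinearlyInseparable (M : StarredMap) : Prop :=
  ∀ A : Set M.Dart, (∀ d ∈ A, M.rev d ∈ A) → A.Nonempty →
    ∃ w w', M.OuterMixed A w ∧ M.OuterMixed A w' ∧ ¬ M.rot.SameCycle w w'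

theorem HasArc.not_sameCycle {M : StarredMap} {L : ℕ} (h : M.HasArc L) (hL : 0 < L) :
    ¬ M.rot.SameCycle M.root M.star := by
  intro hs
  rw [h.star_eq] at hs
  exact hL.ne (h.injOn 0 (Nat.zero_le _) L le_rfl hs)

/-- The case not covered by inseparability is that of all edges; there the root and the star are the
two vertices required. -/
theorem IsLinearlyInseparable.of_isInseparable {M : StarredMap} (h : M.IsInseparable)
    (hM : ¬ M.rot.SameCycle M.root M.star) : M.IsLinearlyInseparable := by
  intro A hA hne
  by_cases hc : Aᶜ.Nonempty
  · obtain ⟨w, w', hw, hw', hww'⟩ := h A hA hne hc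
    exact ⟨w, w', ⟨hw.1, Or.inl hw.2⟩, ⟨hw'.1, Or.inl hw'.2⟩, hww'⟩
  · rw [Set.not_nonempty_iff_eq_empty, Set.compl_empty_iff] at hc
    subst hc
    exact ⟨M.root, M.star, ⟨⟨_, trivial, SameCycle.refl _ _⟩, Or.inr (Or.inl (SameCycle.refl _ _))⟩,
      ⟨⟨_, trivial, SameCycle.refl _ _⟩, Or.inr (Or.inr (SameCycle.refl _ _))⟩, hM⟩

/-! ### Gluing two maps -/

section Glue

variable (M N : StarredMap)

/-- The darts of `M` in `M.glue N`. -/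
def inl (d : M.Dart) : (M.glue N).Dart := Sum.inl d

/-- The darts of `N` in `M.glue N`. -/
def inr (d : N.Dart) : (M.glue N).Dart := Sum.inr d

variable {M N} in
theorem glue_dart_cases (d : (M.glue N).Dart) : (∃ a, d = M.inl N a) ∨ ∃ b, d = M.inr N b := by
  obtain a | b := d
  · exact Or.inl ⟨a, rfl⟩
  · exact Or.inr ⟨b, rfl⟩

theorem glue_rev_inl (d : M.Dart) : (M.glue N).rev (M.inl N d) = M.inl N (M.rev d) := rfl

theorem glue_rev_inr (d : N.Dart) : (M.glue N).rev (M.inr N d) = M.inr N (N.rev d) := rfl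

theorem glue_root : (M.glue N).root = M.inl N M.root := rfl

theorem glue_star : (M.glue N).star = M.inr N N.star := rfl

theorem inl_ne_inr (a : M.Dart) (b : N.Dart) : M.inl N a ≠ M.inr N b := Sum.inl_ne_inr

theorem inl_injective : Function.Injective (M.inl N) := Sum.inl_injective

theorem inr_injective : Function.Injective (M.inr N) := Sum.inr_injective

theorem glue_rot_inl {d : M.Dart} (h : M.rot d ≠ M.star) :
    (M.glue N).rot (M.inl N d) = M.inl N (M.rot d) :=
  swap_apply_of_ne_of_ne (fun h' => h (Sum.inl_injective h')) Sum.inl_ne_inr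

theorem glue_rot_inr {d : N.Dart} (h : N.rot d ≠ N.root) :
    (M.glue N).rot (M.inr N d) = M.inr N (N.rot d) :=
  swap_apply_of_ne_of_ne (a := Sum.inl M.star) Sum.inr_ne_inl
    (fun h' => h (Sum.inr_injective h'))

theorem glue_rot_inl_of_eq {d : M.Dart} (h : M.rot d = M.star) :
    (M.glue N).rot (M.inl N d) = M.inr N N.root := by
  change swap (Sum.inl M.star) (Sum.inr N.root) (Sum.inl (M.rot d)) = Sum.inr N.root
  rw [h, swap_apply_left]

theorem glue_rot_inr_of_eq {d : N.Dart} (h : N.rot d = N.root) :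
    (M.glue N).rot (M.inr N d) = M.inl N M.star := by
  change swap (Sum.inl M.star) (Sum.inr N.root) (Sum.inr (N.rot d)) = Sum.inl M.star
  rw [h, swap_apply_right]

theorem glue_next : (M.glue N).next =
    swap (Sum.inl M.star) (Sum.inr N.root) * Equiv.sumCongr M.next N.next := by
  change (swap (Sum.inl M.star) (Sum.inr N.root) * Equiv.sumCongr M.rot N.rot) *
    Equiv.sumCongr M.rev N.rev = _
  rw [mul_assoc, sumCongr_mul_sumCongr]
  rfl

variable {M N}

theorem glue_sameCycle {x y : M.Dart ⊕ N.Dart} : (M.glue N).rot.SameCycle x y ↔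
    SameCycle (Equiv.sumCongr M.rot N.rot) x y ∨
      (SameCycle (Equiv.sumCongr M.rot N.rot) x (Sum.inl M.star) ∧
        SameCycle (Equiv.sumCongr M.rot N.rot) y (Sum.inr N.root)) ∨
      (SameCycle (Equiv.sumCongr M.rot N.rot) x (Sum.inr N.root) ∧
        SameCycle (Equiv.sumCongr M.rot N.rot) y (Sum.inl M.star)) :=
  sameCycle_swap_mul (σ := (Equiv.sumCongr M.rot N.rot : Perm (M.Dart ⊕ N.Dart)))
    not_sameCycle_sumCongr_inl_inr

theorem glue_sameCycle_inl_inl {a b : M.Dart} :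
    (M.glue N).rot.SameCycle (M.inl N a) (M.inl N b) ↔ M.rot.SameCycle a b := by
  exact (glue_sameCycle (x := Sum.inl a) (y := Sum.inl b)).trans (by simp)

theorem glue_sameCycle_inr_inr {a b : N.Dart} :
    (M.glue N).rot.SameCycle (M.inr N a) (M.inr N b) ↔ N.rot.SameCycle a b := by
  exact (glue_sameCycle (x := Sum.inr a) (y := Sum.inr b)).trans (by simp)

theorem glue_sameCycle_inl_inr {a : M.Dart} {b : N.Dart} :
    (M.glue N).rot.SameCycle (M.inl N a) (M.inr N b) ↔
      M.rot.SameCycle a M.star ∧ N.rot.SameCycle b N.root := by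
  exact (glue_sameCycle (x := Sum.inl a) (y := Sum.inr b)).trans (by simp)

theorem glue_sameCycle_inr_inl {a : M.Dart} {b : N.Dart} :
    (M.glue N).rot.SameCycle (M.inr N b) (M.inl N a) ↔
      M.rot.SameCycle a M.star ∧ N.rot.SameCycle b N.root := by
  rw [sameCycle_comm, glue_sameCycle_inl_inr]

theorem numCycles_glue_rot :
    (M.glue N).rot.numCycles + 1 = M.rot.numCycles + N.rot.numCycles := by
  rw [← numCycles_sumCongr]
  exact numCycles_swap_mul not_sameCycle_sumCongr_inl_inr

theorem numCycles_glue_next :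
    (M.glue N).next.numCycles + 1 = M.next.numCycles + N.next.numCycles := by
  rw [← numCycles_sumCongr, glue_next]
  exact numCycles_swap_mul not_sameCycle_sumCongr_inl_inr

theorem numCycles_glue_rev : (M.glue N).rev.numCycles = M.rev.numCycles + N.rev.numCycles :=
  numCycles_sumCongr _ _

/-- Parallel edges on different sides would have both ends at the gluing vertex and be loops. Gluing
loses one vertex and one face and keeps all edges, which is consistent with Euler's formula. -/
theorem isCactus_glue (hM : M.IsCactus) (hN : N.IsCactus) : (M.glue N).IsCactus where
  loopless := by
    intro d
    obtain ⟨d, rfl⟩ | ⟨d, rfl⟩ := glue_dart_cases d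
    · exact fun h => hM.loopless d (glue_sameCycle_inl_inl.1 h)
    · exact fun h => hN.loopless d (glue_sameCycle_inr_inr.1 h)
  simple := by
    intro d d' h h'
    obtain ⟨d, rfl⟩ | ⟨d, rfl⟩ := glue_dart_cases d <;>
      obtain ⟨d', rfl⟩ | ⟨d', rfl⟩ := glue_dart_cases d'
    · rw [hM.simple d d' (glue_sameCycle_inl_inl.1 h) (glue_sameCycle_inl_inl.1 h')]
    · exact absurd ((glue_sameCycle_inl_inr.1 h).1.trans (glue_sameCycle_inl_inr.1 h').1.symm)
        (hM.loopless d)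
    · exact absurd ((glue_sameCycle_inr_inl.1 h).1.trans (glue_sameCycle_inr_inl.1 h').1.symm)
        (hM.loopless d')
    · rw [hN.simple d d' (glue_sameCycle_inr_inr.1 h) (glue_sameCycle_inr_inr.1 h')]
  spherical := by
    have h1 := hM.spherical
    have h2 := hN.spherical
    have h3 := numCycles_glue_rot (M := M) (N := N)
    have h4 := numCycles_glue_next (M := M) (N := N)
    have h5 := numCycles_glue_rev (M := M) (N := N)
    unfold RootedMap.IsSpherical at *
    omega

theorem glue_next_pow_inr {L : ℕ} (hN : N.HasArc L) : ∀ k ≤ L,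
    ((M.glue N).next ^ k) (M.inr N N.root) = M.inr N ((N.next ^ k) N.root) := by
  intro k
  induction k with
  | zero => exact fun _ => rfl
  | succ k ih =>
    intro hk
    rw [pow_succ', Perm.mul_apply, ih (by omega), pow_succ' N.next, Perm.mul_apply]
    refine glue_rot_inr M N fun h => ?_
    have h' : (N.next ^ (k + 1)) N.root = N.root := by
      rw [pow_succ', Perm.mul_apply]
      exact h
    have := hN.injOn (k + 1) hk 0 (Nat.zero_le _) (by rw [h']; exact SameCycle.refl _ _)
    omega

/-- The bound is strict: the step that would reach the star of `M` is diverted to the root of `N`.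
Earlier steps avoid the star because the arc has distinct vertices. -/
theorem glue_next_pow_inl {L : ℕ} (hM : M.HasArc L) : ∀ k < L,
    ((M.glue N).next ^ k) (M.inl N M.root) = M.inl N ((M.next ^ k) M.root) := by
  intro k
  induction k with
  | zero => exact fun _ => rfl
  | succ k ih =>
    intro hk
    rw [pow_succ', Perm.mul_apply, ih (by omega), pow_succ' M.next, Perm.mul_apply]
    refine glue_rot_inl M N fun h => ?_
    have h' : (M.next ^ (k + 1)) M.root = (M.next ^ L) M.root := by
      rw [pow_succ', Perm.mul_apply, ← hM.star_eq]
      exact h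
    have := hM.injOn (k + 1) hk.le L le_rfl (by rw [h'])
    omega

theorem glue_next_pow {L : ℕ} (hM : M.HasArc L) (hL : 0 < L) :
    ((M.glue N).next ^ L) (M.inl N M.root) = M.inr N N.root := by
  obtain ⟨k, rfl⟩ := Nat.exists_eq_succ_of_ne_zero hL.ne'
  rw [pow_succ', Perm.mul_apply, glue_next_pow_inl hM k (by omega)]
  refine glue_rot_inl_of_eq M N ?_
  rw [hM.star_eq, pow_succ', Perm.mul_apply]
  rfl

theorem HasArc.glue {L L' : ℕ} (hM : M.HasArc L) (hL : 0 < L) (hN : N.HasArc L') :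
    (M.glue N).HasArc (L + L') := by
  have key : ∀ k ≤ L', ((M.glue N).next ^ (L + k)) (M.inl N M.root) =
      M.inr N ((N.next ^ k) N.root) := by
    intro k hk
    rw [add_comm, pow_add, Perm.mul_apply, glue_next_pow hM hL, glue_next_pow_inr hN k hk]
  have cross : ∀ j < L, ∀ k ≤ L', ¬ (M.glue N).rot.SameCycle
      (((M.glue N).next ^ j) (M.inl N M.root)) (((M.glue N).next ^ (L + k)) (M.inl N M.root)) := by
    intro j hj k hk h
    rw [key k hk, glue_next_pow_inl hM j hj, glue_sameCycle_inl_inr, hM.star_eq] at h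
    exact hj.ne (hM.injOn j hj.le L le_rfl h.1)
  refine ⟨by rw [glue_star, glue_root, key L' le_rfl, hN.star_eq], ?_⟩
  intro j hj k hk h
  change (M.glue N).rot.SameCycle (((M.glue N).next ^ j) (M.inl N M.root))
    (((M.glue N).next ^ k) (M.inl N M.root)) at h
  obtain hj' | hj' := lt_or_ge j L <;> obtain hk' | hk' := lt_or_ge k L
  · rw [glue_next_pow_inl hM j hj', glue_next_pow_inl hM k hk', glue_sameCycle_inl_inl] at h
    exact hM.injOn j hj'.le k hk'.le h
  · obtain ⟨k, rfl⟩ := Nat.exists_eq_add_of_le hk'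
    exact absurd h (cross j hj' k (by omega))
  · obtain ⟨j, rfl⟩ := Nat.exists_eq_add_of_le hj'
    exact absurd h.symm (cross k hk' j (by omega))
  · obtain ⟨k, rfl⟩ := Nat.exists_eq_add_of_le hk'
    obtain ⟨j, rfl⟩ := Nat.exists_eq_add_of_le hj'
    rw [key j (by omega), key k (by omega), glue_sameCycle_inr_inr] at h
    rw [hN.injOn j (by omega) k (by omega) h]

/-- If `A` meets both sides, each side provides two vertices, of which at most one is the gluing
vertex; one other vertex is kept from each side. If `A` lies on one side, both vertices of that side
work, the gluing vertex being incident with edges of the other side, outside `A`. -/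
theorem IsLinearlyInseparable.glue (hM : M.IsLinearlyInseparable) (hN : N.IsLinearlyInseparable) :
    (M.glue N).IsLinearlyInseparable := by
  intro A hA hne
  have hAM : ∀ d ∈ (M.inl N ⁻¹' A : Set M.Dart), M.rev d ∈ (M.inl N ⁻¹' A : Set M.Dart) :=
    fun d hd => hA _ hd
  have hAN : ∀ d ∈ (M.inr N ⁻¹' A : Set N.Dart), N.rev d ∈ (M.inr N ⁻¹' A : Set N.Dart) :=
    fun d hd => hA _ hd
  have leftMixed : ∀ w, M.OuterMixed (M.inl N ⁻¹' A) w →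
      ((¬ M.rot.SameCycle M.star w) ∨ M.inr N N.root ∉ A) →
      (M.glue N).OuterMixed A (M.inl N w) := by
    rintro w ⟨⟨a, ha, haw⟩, hw⟩ hs
    refine ⟨⟨M.inl N a, ha, glue_sameCycle_inl_inl.2 haw⟩, ?_⟩
    obtain ⟨b, hb, hbw⟩ | hw | hw := hw
    · exact Or.inl ⟨M.inl N b, hb, glue_sameCycle_inl_inl.2 hbw⟩
    · exact Or.inr (Or.inl (glue_sameCycle_inl_inl.2 hw))
    · exact Or.inl ⟨M.inr N N.root, hs.resolve_left (not_not.2 hw),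
        glue_sameCycle_inr_inl.2 ⟨hw.symm, SameCycle.refl _ _⟩⟩
  have rightMixed : ∀ w, N.OuterMixed (M.inr N ⁻¹' A) w →
      ((¬ N.rot.SameCycle N.root w) ∨ M.inl N M.star ∉ A) →
      (M.glue N).OuterMixed A (M.inr N w) := by
    rintro w ⟨⟨a, ha, haw⟩, hw⟩ hs
    refine ⟨⟨M.inr N a, ha, glue_sameCycle_inr_inr.2 haw⟩, ?_⟩
    obtain ⟨b, hb, hbw⟩ | hw | hw := hw
    · exact Or.inl ⟨M.inr N b, hb, glue_sameCycle_inr_inr.2 hbw⟩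
    · exact Or.inl ⟨M.inl N M.star, hs.resolve_left (not_not.2 hw),
        glue_sameCycle_inl_inr.2 ⟨SameCycle.refl _ _, hw.symm⟩⟩
    · exact Or.inr (Or.inr (glue_sameCycle_inr_inr.2 hw))
  by_cases hl : (M.inl N ⁻¹' A : Set M.Dart).Nonempty
  · obtain ⟨w, w', hw, hw', hww'⟩ := hM _ hAM hl
    by_cases hr : (M.inr N ⁻¹' A : Set N.Dart).Nonempty
    · obtain ⟨v, v', hv, hv', hvv'⟩ := hN _ hAN hr
      obtain ⟨u, hu, hu'⟩ : ∃ u, M.OuterMixed (M.inl N ⁻¹' A) u ∧ ¬ M.rot.SameCycle M.star u := by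
        by_cases h : M.rot.SameCycle M.star w
        · exact ⟨w', hw', fun h' => hww' (h.symm.trans h')⟩
        · exact ⟨w, hw, h⟩
      obtain ⟨x, hx, hx'⟩ : ∃ u, N.OuterMixed (M.inr N ⁻¹' A) u ∧ ¬ N.rot.SameCycle N.root u := by
        by_cases h : N.rot.SameCycle N.root v
        · exact ⟨v', hv', fun h' => hvv' (h.symm.trans h')⟩
        · exact ⟨v, hv, h⟩
      exact ⟨M.inl N u, M.inr N x, leftMixed u hu (Or.inl hu'), rightMixed x hx (Or.inl hx'),
        fun h => hu' (glue_sameCycle_inl_inr.1 h).1.symm⟩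
    · have hr' : M.inr N N.root ∉ A := fun h => hr ⟨_, h⟩
      exact ⟨M.inl N w, M.inl N w', leftMixed w hw (Or.inr hr'), leftMixed w' hw' (Or.inr hr'),
        fun h => hww' (glue_sameCycle_inl_inl.1 h)⟩
  · have hr : (M.inr N ⁻¹' A : Set N.Dart).Nonempty := by
      obtain ⟨d, hd⟩ := hne
      obtain ⟨d, rfl⟩ | ⟨d, rfl⟩ := glue_dart_cases d
      · exact absurd ⟨d, hd⟩ hl
      · exact ⟨d, hd⟩
    have hl' : M.inl N M.star ∉ A := fun h => hl ⟨_, h⟩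
    obtain ⟨v, v', hv, hv', hvv'⟩ := hN _ hAN hr
    exact ⟨M.inr N v, M.inr N v', rightMixed v hv (Or.inr hl'), rightMixed v' hv' (Or.inr hl'),
      fun h => hvv' (glue_sameCycle_inr_inr.1 h)⟩

/-- An edge lies on one side. If on the left, an end at the star would force root and star of `N` to
coincide; if on the right, an end at the root would force the same in `M`. -/
theorem glue_not_adjacent (hM : ¬ M.rot.SameCycle M.root M.star)
    (hN : ¬ N.rot.SameCycle N.root N.star) (d : (M.glue N).Dart) :
    ¬ ((M.glue N).rot.SameCycle d (M.glue N).root ∧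
      (M.glue N).rot.SameCycle ((M.glue N).rev d) (M.glue N).star) := by
  rintro ⟨h, h'⟩
  obtain ⟨d, rfl⟩ | ⟨d, rfl⟩ := glue_dart_cases d
  · exact hN (glue_sameCycle_inl_inr.1 h').2.symm
  · exact hM (glue_sameCycle_inr_inl.1 h).1

end Glue

/-! ### Adding the root edge -/

section Close

variable (M : StarredMap)

/-- The darts of `M` in `M.close`. -/
def old (d : M.Dart) : M.close.Dart := Sum.inr d

/-- The new root dart of `M.close` (`true`) and its reverse (`false`). -/
def new (b : Bool) : M.close.Dart := Sum.inl b

variable {M} in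
theorem close_dart_cases (d : M.close.Dart) :
    d = M.new true ∨ d = M.new false ∨ ∃ a, d = M.old a := by
  obtain (_ | _) | a := d
  · exact Or.inr (Or.inl rfl)
  · exact Or.inl rfl
  · exact Or.inr (Or.inr ⟨a, rfl⟩)

theorem close_rev_old (d : M.Dart) : M.close.rev (M.old d) = M.old (M.rev d) := rfl

theorem old_injective : Function.Injective M.old := Sum.inr_injective

theorem new_injective : Function.Injective M.new := Sum.inl_injective

theorem old_ne_new (d : M.Dart) (b : Bool) : M.old d ≠ M.new b := Sum.inr_ne_inl

theorem close_rot_new_true : M.close.rot (M.new true) = M.old M.star := by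
  change swap (Sum.inl true) (Sum.inr M.star)
    (swap (Sum.inl false) (Sum.inr M.root) (Sum.inl true)) = Sum.inr M.star
  rw [swap_apply_of_ne_of_ne (a := Sum.inl false) (by simp) (by simp), swap_apply_left]

theorem close_rot_new_false (h : M.root ≠ M.star) : M.close.rot (M.new false) = M.old M.root := by
  change swap (Sum.inl true) (Sum.inr M.star)
    (swap (Sum.inl false) (Sum.inr M.root) (Sum.inl false)) = Sum.inr M.root
  rw [swap_apply_left, swap_apply_of_ne_of_ne (by simp) (by simpa using h)]

theorem close_rot_old {d : M.Dart} (h : M.rot d ≠ M.root) (h' : M.rot d ≠ M.star) :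
    M.close.rot (M.old d) = M.old (M.rot d) := by
  change swap (Sum.inl true) (Sum.inr M.star)
    (swap (Sum.inl false) (Sum.inr M.root) (Sum.inr (M.rot d))) = Sum.inr (M.rot d)
  rw [swap_apply_of_ne_of_ne (a := Sum.inl false) (by simp) (by simpa using h),
    swap_apply_of_ne_of_ne (by simp) (by simpa using h')]

theorem close_rot_old_of_eq_root {d : M.Dart} (h : M.rot d = M.root) :
    M.close.rot (M.old d) = M.new false := by
  change swap (Sum.inl true) (Sum.inr M.star)
    (swap (Sum.inl false) (Sum.inr M.root) (Sum.inr (M.rot d))) = Sum.inl false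
  rw [h, swap_apply_right, swap_apply_of_ne_of_ne (by simp) (by simp)]

theorem close_rot_old_of_eq_star {d : M.Dart} (h : M.rot d = M.star) (h' : M.root ≠ M.star) :
    M.close.rot (M.old d) = M.new true := by
  change swap (Sum.inl true) (Sum.inr M.star)
    (swap (Sum.inl false) (Sum.inr M.root) (Sum.inr (M.rot d))) = Sum.inl true
  rw [h, swap_apply_of_ne_of_ne (a := Sum.inl false) (by simp) (by simpa using h'.symm),
    swap_apply_right]

variable {M}

/-- A dart of `M` at the vertex of the given dart of `M.close`. -/
def attach : M.close.Dart → M.Dart :=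
  Sum.elim (fun b => if b then M.star else M.root) id

/-- The two new darts are inserted into existing vertices, so the vertices of `M.close` are those of
`M`. -/
theorem close_sameCycle (h : M.root ≠ M.star) {x y : M.close.Dart} :
    M.close.rot.SameCycle x y ↔ M.rot.SameCycle (attach x) (attach y) := by
  constructor
  · refine SameCycle.of_equivalence (R := fun x y => M.rot.SameCycle (attach x) (attach y))
      ⟨fun _ => SameCycle.refl _ _, SameCycle.symm, SameCycle.trans⟩ fun x => ?_
    obtain rfl | rfl | ⟨d, rfl⟩ := close_dart_cases x
    · rw [close_rot_new_true]
      exact SameCycle.refl _ _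
    · rw [close_rot_new_false M h]
      exact SameCycle.refl _ _
    · have h0 : attach (M.old d) = d := rfl
      have h1 := sameCycle_apply_self M.rot d
      by_cases hr : M.rot d = M.root
      · rw [close_rot_old_of_eq_root M hr, h0]
        rwa [hr] at h1
      · by_cases hs : M.rot d = M.star
        · rw [close_rot_old_of_eq_star M hs h, h0]
          rwa [hs] at h1
        · rw [close_rot_old M hr hs, h0]
          exact h1
  · have key : ∀ x : M.close.Dart, M.close.rot.SameCycle x (M.old (attach x)) := by
      intro x
      obtain rfl | rfl | ⟨d, rfl⟩ := close_dart_cases x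
      · exact close_rot_new_true M ▸ sameCycle_apply_self M.close.rot (M.new true)
      · exact close_rot_new_false M h ▸ sameCycle_apply_self M.close.rot (M.new false)
      · exact SameCycle.refl _ _
    have step : ∀ d : M.Dart, M.close.rot.SameCycle (M.old d) (M.old (M.rot d)) := by
      intro d
      have h1 := sameCycle_apply_self M.close.rot (M.old d)
      by_cases hr : M.rot d = M.root
      · rw [close_rot_old_of_eq_root M hr] at h1
        exact h1.trans (hr ▸ key (M.new false))
      · by_cases hs : M.rot d = M.star
        · rw [close_rot_old_of_eq_star M hs h] at h1
          exact h1.trans (hs ▸ key (M.new true))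
        · rwa [close_rot_old M hr hs] at h1
    intro hxy
    refine (key x).trans (SameCycle.trans ?_ (key y).symm)
    exact SameCycle.of_equivalence (R := fun a b => M.close.rot.SameCycle (M.old a) (M.old b))
      ⟨fun _ => SameCycle.refl _ _, SameCycle.symm, SameCycle.trans⟩ step hxy

theorem attach_old (d : M.Dart) : attach (M.old d) = d := rfl

theorem attach_new_true : attach (M.new true) = M.star := rfl

theorem numCycles_close_rot : M.close.rot.numCycles = M.rot.numCycles := by
  have h1 : numCycles (swap (Sum.inl false) (Sum.inr M.root) *
      (Equiv.sumCongr (Equiv.refl Bool) M.rot : Perm (Bool ⊕ M.Dart))) + 1 = _ :=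
    numCycles_swap_mul not_sameCycle_sumCongr_inl_inr
  have h2 : numCycles (swap (Sum.inl true) (Sum.inr M.star) *
      (swap (Sum.inl false) (Sum.inr M.root) *
      (Equiv.sumCongr (Equiv.refl Bool) M.rot : Perm (Bool ⊕ M.Dart)))) + 1 =
      numCycles (swap (Sum.inl false) (Sum.inr M.root) *
      (Equiv.sumCongr (Equiv.refl Bool) M.rot : Perm (Bool ⊕ M.Dart))) := by
    -- After the first merge `true` is still a fixed point, so the second transposition merges too.
    -- The two merges absorb the two fixed points contributed by the new edge.
    refine numCycles_swap_mul ?_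
    rw [sameCycle_swap_mul not_sameCycle_sumCongr_inl_inr]
    have : ¬ SameCycle (Equiv.refl Bool) true false := by
      rw [show Equiv.refl Bool = (1 : Perm Bool) from rfl, sameCycle_one]
      simp
    simp [this]
  have h3 : M.close.rot.numCycles = numCycles (swap (Sum.inl true) (Sum.inr M.star) *
      (swap (Sum.inl false) (Sum.inr M.root) *
      (Equiv.sumCongr (Equiv.refl Bool) M.rot : Perm (Bool ⊕ M.Dart)))) := rfl
  rw [numCycles_sumCongr, show Equiv.refl Bool = (1 : Perm Bool) from rfl, numCycles_one,
    Nat.card_eq_fintype_card, Fintype.card_bool] at h1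
  rw [show Equiv.refl Bool = (1 : Perm Bool) from rfl] at h2 h3
  omega

theorem numCycles_close_rev : M.close.rev.numCycles = M.rev.numCycles + 1 := by
  have : M.close.rev.numCycles = _ := numCycles_sumCongr Equiv.boolNot M.rev
  rw [this, numCycles_boolNot, add_comm]

theorem close_next : M.close.next = (swap (Sum.inl true) (Sum.inr M.star) *
    (swap (Sum.inl false) (Sum.inr M.root) * Equiv.sumCongr Equiv.boolNot M.next) :
      Perm (Bool ⊕ M.Dart)) := by
  change (swap (Sum.inl true) (Sum.inr M.star) * (swap (Sum.inl false) (Sum.inr M.root) *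
    Equiv.sumCongr (Equiv.refl Bool) M.rot)) * Equiv.sumCongr Equiv.boolNot M.rev = _
  rw [mul_assoc, mul_assoc, sumCongr_mul_sumCongr]
  rfl

section Arc

variable {L : ℕ} (h : M.HasArc L) (hL : 0 < L)

include h hL

theorem HasArc.root_ne_star : M.root ≠ M.star :=
  fun h' => h.not_sameCycle hL (h' ▸ SameCycle.refl _ _)

/-- The exponent is shifted by one because the walk starts with the new root dart, which ends at the
old root vertex. -/
theorem close_next_pow : ∀ k < L,
    (M.close.next ^ (k + 1)) (M.new true) = M.old ((M.next ^ k) M.root) := by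
  intro k
  induction k with
  | zero =>
    intro _
    rw [zero_add, pow_one]
    exact close_rot_new_false M (h.root_ne_star hL)
  | succ k ih =>
    intro hk
    rw [pow_succ', Perm.mul_apply, ih (by omega), pow_succ' M.next, Perm.mul_apply]
    refine close_rot_old M (fun h0 => ?_) fun h0 => ?_
    · have h' : (M.next ^ (k + 1)) M.root = (M.next ^ 0) M.root := by
        rw [pow_succ', Perm.mul_apply]
        exact h0
      have := h.injOn (k + 1) hk.le 0 (Nat.zero_le _) (by rw [h'])
      omega
    · have h' : (M.next ^ (k + 1)) M.root = (M.next ^ L) M.root := by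
        rw [pow_succ', Perm.mul_apply, ← h.star_eq]
        exact h0
      have := h.injOn (k + 1) hk.le L le_rfl (by rw [h'])
      omega

theorem close_next_old {k : ℕ} (hk : k + 1 = L) :
    M.close.next (M.old ((M.next ^ k) M.root)) = M.new true := by
  refine close_rot_old_of_eq_star M ?_ (h.root_ne_star hL)
  rw [h.star_eq, ← hk, pow_succ', Perm.mul_apply]
  rfl

/-- The new root face consists of the new root dart and the darts of the arc before the star, and no
other dart; the dart `star` belongs to the face on the other side of the new edge. -/
theorem not_sameCycle_close_next : ¬ M.close.next.SameCycle (M.new true) (M.old M.star) := by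
  intro hs
  obtain ⟨n, hn⟩ := hs.exists_nat_pow_eq
  have key : ∀ n : ℕ, (M.close.next ^ n) (M.new true) = M.new true ∨
      ∃ k < L, (M.close.next ^ n) (M.new true) = M.old ((M.next ^ k) M.root) := by
    intro n
    induction n with
    | zero => exact Or.inl rfl
    | succ n ih =>
      rw [pow_succ', Perm.mul_apply]
      obtain ih | ⟨k, hk, ih⟩ := ih
      · rw [ih]
        exact Or.inr ⟨0, hL, by simpa using close_next_pow h hL 0 hL⟩
      · rw [ih]
        obtain hk' | hk' := (Nat.succ_le_of_lt hk).eq_or_lt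
        · exact Or.inl (close_next_old h hL hk')
        · refine Or.inr ⟨k + 1, hk', ?_⟩
          rw [← close_next_pow h hL k hk, ← close_next_pow h hL _ hk', pow_succ' _ (k + 1),
            Perm.mul_apply]
  obtain h1 | ⟨k, hk, h1⟩ := key n
  · exact old_ne_new M _ _ (hn.symm.trans h1)
  · have h2 := old_injective M (hn.symm.trans h1)
    rw [h.star_eq] at h2
    have := h.injOn L le_rfl k hk.le (by rw [h2])
    omega

/-- The first transposition merges the 2-cycle of the new edge into the face of the old root; the
second cuts that face in two. -/
theorem numCycles_close_next : M.close.next.numCycles = M.next.numCycles + 1 := by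
  have h1 : numCycles (swap (Sum.inl false) (Sum.inr M.root) *
      (Equiv.sumCongr Equiv.boolNot M.next : Perm (Bool ⊕ M.Dart))) + 1 = _ :=
    numCycles_swap_mul not_sameCycle_sumCongr_inl_inr
  have h2 : M.close.next.numCycles = numCycles (swap (Sum.inl false) (Sum.inr M.root) *
      (Equiv.sumCongr Equiv.boolNot M.next : Perm (Bool ⊕ M.Dart))) + 1 := by
    have h3 := not_sameCycle_close_next h hL
    rw [close_next] at h3 ⊢
    exact numCycles_swap_mul_of_not_sameCycle h3
  rw [numCycles_sumCongr, numCycles_boolNot] at h1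
  omega

/-- Going round the new root face, one starts at the old star vertex and then meets the first `L`
vertices of the old arc, so up to `L` steps no vertex is repeated. For a node, `L` is the sum of the
labels of its children. -/
theorem hasArc_mark_close {i : ℕ} (hi : i ≤ L) : (mark M.close i).HasArc i where
  star_eq := rfl
  injOn := by
    have h0 := h.root_ne_star hL
    have h1 : ∀ k < L, ¬ M.close.rot.SameCycle ((M.close.next ^ 0) (M.new true))
        ((M.close.next ^ (k + 1)) (M.new true)) := by
      intro k hk hs
      rw [close_next_pow h hL k hk, pow_zero, Perm.one_apply, close_sameCycle h0, attach_old,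
        attach_new_true, h.star_eq] at hs
      exact hk.ne' (h.injOn L le_rfl k hk.le hs)
    rintro (_ | j) hj (_ | k) hk hs
    · rfl
    · exact absurd hs (h1 k (by omega))
    · exact absurd hs.symm (h1 j (by omega))
    · change M.close.rot.SameCycle ((M.close.next ^ (j + 1)) (M.new true))
        ((M.close.next ^ (k + 1)) (M.new true)) at hs
      rw [close_next_pow h hL k (by omega), close_next_pow h hL j (by omega), close_sameCycle h0,
        attach_old, attach_old] at hs
      rw [h.injOn j (by omega) k (by omega) hs]

theorem isCactus_close (hM : M.IsCactus)
    (hadj : ∀ d, ¬ (M.rot.SameCycle d M.root ∧ M.rot.SameCycle (M.rev d) M.star)) :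
    M.close.IsCactus where
  loopless := by
    intro d
    rw [close_sameCycle (h.root_ne_star hL)]
    obtain rfl | rfl | ⟨d, rfl⟩ := close_dart_cases d
    · exact fun h' => h.not_sameCycle hL h'.symm
    · exact h.not_sameCycle hL
    · exact hM.loopless d
  simple := by
    have hadj' : ∀ d, ¬ (M.rot.SameCycle d M.star ∧ M.rot.SameCycle (M.rev d) M.root) :=
      fun d hd => hadj (M.rev d) ⟨hd.2, by rw [M.rev_rev]; exact hd.1⟩
    intro d d'
    rw [close_sameCycle (h.root_ne_star hL), close_sameCycle (h.root_ne_star hL)]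
    obtain rfl | rfl | ⟨d, rfl⟩ := close_dart_cases d <;>
      obtain rfl | rfl | ⟨d', rfl⟩ := close_dart_cases d' <;> intro h1 h2
    · rfl
    · exact absurd h1.symm (h.not_sameCycle hL)
    · exact absurd ⟨h1.symm, h2.symm⟩ (hadj' d')
    · exact absurd h1 (h.not_sameCycle hL)
    · rfl
    · exact absurd ⟨h1.symm, h2.symm⟩ (hadj d')
    · exact absurd ⟨h1, h2⟩ (hadj' d)
    · exact absurd ⟨h1, h2⟩ (hadj d)
    · rw [hM.simple d d' h1 h2]
  spherical := by
    have h1 := hM.spherical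
    have h2 := numCycles_close_rot (M := M)
    have h3 := numCycles_close_rev (M := M)
    have h4 := numCycles_close_next h hL
    unfold RootedMap.IsSpherical at *
    omega

/-- Mixed vertices are the same for `A` and its complement, so the new edge may be assumed outside
`A`. It then makes the old root and star incident with the complement. -/
theorem IsLinearlyInseparable.close (hM : M.IsLinearlyInseparable) :
    M.close.IsInseparable := by
  have h0 := h.root_ne_star hL
  have key : ∀ A : Set M.close.Dart, (∀ d ∈ A, M.close.rev d ∈ A) → A.Nonempty →
      M.new true ∉ A →
      ∃ w w', M.close.Mixed A w ∧ M.close.Mixed A w' ∧ ¬ M.close.rot.SameCycle w w' := by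
    intro A hA hne ht
    have hf : M.new false ∉ A := fun hf => ht (hA _ hf)
    have hA' : ∀ d ∈ (M.old ⁻¹' A), M.rev d ∈ (M.old ⁻¹' A) := fun d hd => hA _ hd
    have hne' : (M.old ⁻¹' A).Nonempty := by
      obtain ⟨x, hx⟩ := hne
      obtain rfl | rfl | ⟨d, rfl⟩ := close_dart_cases x
      · exact absurd hx ht
      · exact absurd hx hf
      · exact ⟨d, hx⟩
    have mixed : ∀ w, M.OuterMixed (M.old ⁻¹' A) w → M.close.Mixed A (M.old w) := by
      rintro w ⟨⟨a, ha, haw⟩, hw⟩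
      refine ⟨⟨M.old a, ha, (close_sameCycle h0).2 haw⟩, ?_⟩
      obtain ⟨b, hb, hbw⟩ | hw | hw := hw
      · exact ⟨M.old b, hb, (close_sameCycle h0).2 hbw⟩
      · exact ⟨M.new false, hf, (close_sameCycle h0).2 hw⟩
      · exact ⟨M.new true, ht, (close_sameCycle h0).2 hw⟩
    obtain ⟨w, w', hw, hw', hww'⟩ := hM _ hA' hne'
    exact ⟨M.old w, M.old w', mixed w hw, mixed w' hw', fun h' => hww' ((close_sameCycle h0).1 h')⟩
  intro A hA hne hc
  by_cases ht : M.new true ∈ A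
  · obtain ⟨w, w', hw, hw', hww'⟩ := key Aᶜ (RootedMap.rev_mem_compl hA) hc (not_not.2 ht)
    exact ⟨w, w', hw.compl, hw'.compl, hww'⟩
  · exact key A hA hne ht

end Arc

end Close

end StarredMap

/-! ### The map of a tree -/

namespace StarredMap

open Equiv Equiv.Perm

/-- The starred maps of the nodes: inseparable, with the star at distance `i` along the root
face. -/
structure IsBlock (M : StarredMap) (i : ℕ) : Prop where
  inseparable : M.IsInseparable
  cactus : M.IsCactus
  arc : M.HasArc i
  pos : 0 < i

/-- The chains of blocks, with the star at distance `L` along the root face. -/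
structure IsBlockChain (M : StarredMap) (L : ℕ) : Prop where
  inseparable : M.IsLinearlyInseparable
  cactus : M.IsCactus
  arc : M.HasArc L
  pos : 0 < L

theorem IsBlock.isBlockChain {M : StarredMap} {i : ℕ} (h : M.IsBlock i) : M.IsBlockChain i :=
  ⟨.of_isInseparable h.inseparable (h.arc.not_sameCycle h.pos), h.cactus, h.arc, h.pos⟩

theorem IsBlockChain.glue {M N : StarredMap} {L L' : ℕ} (hM : M.IsBlockChain L)
    (hN : N.IsBlockChain L') : (M.glue N).IsBlockChain (L + L') :=
  ⟨hM.inseparable.glue hN.inseparable, isCactus_glue hM.cactus hN.cactus, hM.arc.glue hM.pos hN.arc,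
    Nat.add_pos_left hM.pos _⟩

/-- Inseparability is vacuous: a single edge has no proper nonempty subset of edges. -/
theorem isBlock_mark_link : (mark link 1).IsBlock 1 where
  inseparable := by
    intro A hA ⟨a, ha⟩ ⟨b, hb⟩
    have h : b = a ∨ b = link.rev a := by
      cases a <;> cases b
      · exact Or.inl rfl
      · exact Or.inr rfl
      · exact Or.inr rfl
      · exact Or.inl rfl
    obtain rfl | rfl := h
    · exact absurd ha hb
    · exact absurd (hA _ ha) hb
  cactus := by
    refine ⟨fun d h => ?_, fun d d' h _ => sameCycle_one.1 h, ?_⟩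
    · exact (mark link 1).rev_ne d (sameCycle_one.1 h).symm
    · have h1 : (mark link 1).rot.numCycles = Nat.card Bool := numCycles_one
      have h2 : (mark link 1).rev.numCycles = 1 := numCycles_boolNot
      have h3 : (mark link 1).next.numCycles = 1 := by
        rw [← numCycles_boolNot]
        exact congrArg numCycles (one_mul Equiv.boolNot)
      rw [Nat.card_eq_fintype_card, Fintype.card_bool] at h1
      unfold RootedMap.IsSpherical
      omega
  arc := by
    refine ⟨rfl, fun j hj k hk h => ?_⟩
    have h' := sameCycle_one.1 h
    interval_cases j <;> interval_cases k
    · rfl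
    · exact absurd (show true = false from h') (by simp)
    · exact absurd (show false = true from h') (by simp)
    · rfl
  pos := one_pos

end StarredMap

namespace LabelledTree

open StarredMap

theorem induction_on {P : LabelledTree → Prop}
    (h : ∀ l cs, (∀ c ∈ cs, P c) → P (node l cs)) (t : LabelledTree) : P t :=
  LabelledTree.rec (motive_1 := P) (motive_2 := fun cs => ∀ c ∈ cs, P c) (fun l cs => h l cs)
    (by simp) (fun c cs hc hcs => by simpa using ⟨hc, hcs⟩) t

theorem nodesOfForest_eq_flatMap (cs : List LabelledTree) :
    nodesOfForest cs = cs.flatMap nodes := by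
  induction cs with
  | nil => simp [nodesOfForest]
  | cons c cs ih => simp [nodesOfForest, ih]

theorem nodes_node (l : ℕ) (cs : List LabelledTree) :
    (node l cs).nodes = node l cs :: cs.flatMap nodes := by
  rw [nodes, nodesOfForest_eq_flatMap]

theorem nonRootNodes_node (l : ℕ) (cs : List LabelledTree) :
    (node l cs).nonRootNodes = cs.flatMap nodes := nodesOfForest_eq_flatMap cs

theorem numNodes_node (l : ℕ) (cs : List LabelledTree) :
    (node l cs).numNodes = (cs.map numNodes).sum + 1 := by
  rw [numNodes, nodes_node, List.length_cons, List.length_flatMap]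
  rfl

theorem toStarredMaps_eq_map (cs : List LabelledTree) :
    toStarredMaps cs = cs.map toStarredMap := by
  induction cs with
  | nil => simp [toStarredMaps]
  | cons c cs ih => simp [toStarredMaps, ih]

theorem toStarredMap_node (l : ℕ) (cs : List LabelledTree) :
    (node l cs).toStarredMap = assemble l (cs.map toStarredMap) := by
  rw [toStarredMap, toStarredMaps_eq_map]

/-- The local conditions on a node of the trees considered. -/
def IsProperNode (s : LabelledTree) : Prop :=
  0 < s.label ∧ (s.children = [] → s.label = 1) ∧ (s.children ≠ [] → s.label ≤ s.childSum) ∧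
    s.children.length ≠ 1

/-- Subtrees of β(1,0)-trees in which every node other than the root has a sibling. -/
def IsProper (t : LabelledTree) : Prop := ∀ s ∈ t.nodes, s.IsProperNode

theorem isProper_node {l : ℕ} {cs : List LabelledTree} :
    (node l cs).IsProper ↔ (node l cs).IsProperNode ∧ ∀ c ∈ cs, c.IsProper := by
  simp only [IsProper, nodes_node, List.mem_cons, List.mem_flatMap]
  constructor
  · exact fun h => ⟨h _ (Or.inl rfl), fun c hc s hs => h s (Or.inr ⟨c, hc, hs⟩)⟩
  · rintro ⟨h1, h2⟩ s (rfl | ⟨c, hc, hs⟩)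
    · exact h1
    · exact h2 c hc s hs

theorem everyNonRootHasSibling_iff {t : LabelledTree} :
    t.EveryNonRootHasSibling ↔ ∀ s ∈ t.nodes, s.children.length ≠ 1 := by
  refine forall₂_congr fun s _ => ⟨fun h h1 => ?_, fun h i => ?_⟩
  · obtain ⟨j, hj⟩ := h ⟨0, by omega⟩
    exact hj (Fin.ext (by have := j.2; simp only; omega))
  · have hi := i.2
    by_cases h0 : i.1 = 0
    · exact ⟨⟨1, by omega⟩, fun h' => by rw [← h'] at h0; simp at h0⟩
    · exact ⟨⟨0, by omega⟩, fun h' => h0 (by rw [← h'])⟩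

theorem IsBeta10.isProper {t : LabelledTree} (h : t.IsBeta10) (h' : t.EveryNonRootHasSibling) :
    t.IsProper := by
  intro s hs
  refine ⟨h.label_pos s hs, h.label_leaf s hs, fun hc => ?_, everyNonRootHasSibling_iff.1 h' s hs⟩
  obtain ⟨l, cs⟩ := t
  have hs' := hs
  rw [nodes_node, List.mem_cons, ← nonRootNodes_node l cs] at hs'
  obtain rfl | hs' := hs'
  · exact (h.label_root hc).le
  · exact h.label_le s hs' hc

theorem isBlockChain_chain (t : LabelledTree) (ts : List LabelledTree)
    (h : ∀ c ∈ t :: ts, c.toStarredMap.IsBlock c.label) :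
    (chain t.toStarredMap (ts.map toStarredMap)).IsBlockChain ((t :: ts).map label).sum := by
  induction ts generalizing t with
  | nil => simpa [chain] using (h t (by simp)).isBlockChain
  | cons u us ih =>
    exact (h t (by simp)).isBlockChain.glue (ih u fun c hc => h c (List.mem_cons_of_mem _ hc))

theorem IsProper.isBlock {t : LabelledTree} (h : t.IsProper) : t.toStarredMap.IsBlock t.label := by
  induction t using induction_on with
  | _ l cs ih =>
    rw [isProper_node] at h
    obtain ⟨⟨h0, h1, h2, h3⟩, h4⟩ := h
    rw [toStarredMap_node]
    match cs, h1, h2, h3, h4, ih with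
    | [], h1, _, _, _, _ =>
      have h1 : l = 1 := h1 rfl
      subst h1
      exact isBlock_mark_link
    -- The only child case: closing a single block could create a parallel edge.
    | [t], _, _, h3, _, _ => exact absurd rfl h3
    | t :: u :: us, _, h2, _, h4, ih =>
      have hb := fun c hc => ih c hc (h4 c hc)
      have hc := isBlockChain_chain t (u :: us) hb
      have hu := isBlockChain_chain u us fun c hc => hb c (List.mem_cons_of_mem _ hc)
      have ht := hb t (by simp)
      exact ⟨hc.inseparable.close hc.arc hc.pos, isCactus_close hc.arc hc.pos hc.cactus
        (glue_not_adjacent (ht.arc.not_sameCycle ht.pos) (hu.arc.not_sameCycle hu.pos)),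
        hasArc_mark_close hc.arc hc.pos (h2 (by simp [children])), h0⟩

theorem numCycles_rev_chain (t : LabelledTree) (ts : List LabelledTree)
    (h : ∀ c ∈ t :: ts, c.toStarredMap.rev.numCycles = c.numNodes) :
    (chain t.toStarredMap (ts.map toStarredMap)).rev.numCycles =
      ((t :: ts).map numNodes).sum := by
  induction ts generalizing t with
  | nil => exact (h t (by simp)).trans (by simp)
  | cons u us ih =>
    refine numCycles_glue_rev.trans ?_
    rw [ih u fun c hc => h c (List.mem_cons_of_mem _ hc), h t (by simp)]
    simp

theorem numCycles_toStarredMap_rev (t : LabelledTree) :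
    t.toStarredMap.rev.numCycles = t.numNodes := by
  induction t using induction_on with
  | _ l cs ih =>
    rw [toStarredMap_node, numNodes_node]
    match cs, ih with
    | [], _ => exact Equiv.Perm.numCycles_boolNot
    | t :: ts, ih =>
      rw [← numCycles_rev_chain t ts ih]
      exact numCycles_close_rev

theorem numEdges_toMap (t : LabelledTree) : t.toMap.numEdges = t.numNodes :=
  numCycles_toStarredMap_rev t

theorem IsProper.isNonseparablePlanar {t : LabelledTree} (h : t.IsProper) :
    t.toMap.IsNonseparablePlanar :=
  h.isBlock.inseparable.isNonseparablePlanar h.isBlock.cactus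

theorem IsProper.isMultipleEdgeFree {t : LabelledTree} (h : t.IsProper) :
    t.toMap.IsMultipleEdgeFree :=
  h.isBlock.cactus.simple.isMultipleEdgeFree

end LabelledTree

/-! ### The tree is determined by its map -/

theorem Equiv.exists_restrict {X Y A B : Type*} (f : X ≃ Y) {i : A → X} {j : B → Y}
    (hi : Function.Injective i) (hj : Function.Injective j) (h : ∀ a, ∃ b, f (i a) = j b)
    (h' : ∀ b, ∃ a, f (i a) = j b) : ∃ g : A ≃ B, ∀ a, f (i a) = j (g a) := by
  choose g hg using h
  refine ⟨Equiv.ofBijective g ⟨fun a a' ha => hi (f.injective ?_), fun b => ?_⟩, hg⟩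
  · rw [hg, hg, ha]
  · obtain ⟨a, ha⟩ := h' b
    exact ⟨a, hj ((hg a).symm.trans ha)⟩

namespace StarredMap

open Equiv Equiv.Perm

/-- Isomorphisms of rooted maps respecting the star. -/
def StarIso (M N : StarredMap) : Prop :=
  ∃ f : M.Dart ≃ N.Dart, (∀ d, f (M.rot d) = N.rot (f d)) ∧ (∀ d, f (M.rev d) = N.rev (f d)) ∧
    f M.root = N.root ∧ f M.star = N.star

theorem StarIso.iso {M N : StarredMap} : M.StarIso N → RootedMap.Iso M.toRootedMap N.toRootedMap :=
  fun ⟨f, h1, h2, h3, _⟩ => ⟨f, h1, h2, h3⟩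

end StarredMap

theorem RootedMap.sameCycle_iff_of_equiv {M N : RootedMap} (f : M.Dart ≃ N.Dart)
    (h : ∀ d, f (M.rot d) = N.rot (f d)) {a b : M.Dart} :
    N.rot.SameCycle (f a) (f b) ↔ M.rot.SameCycle a b := by
  have key : ∀ n : ℕ, ∀ a, f ((M.rot ^ n) a) = (N.rot ^ n) (f a) := by
    intro n
    induction n with
    | zero => exact fun _ => rfl
    | succ n ih =>
      intro a
      rw [pow_succ', Equiv.Perm.mul_apply, h, ih, pow_succ', Equiv.Perm.mul_apply]
  constructor <;> intro hs <;> obtain ⟨n, hn⟩ := hs.exists_nat_pow_eq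
  · rw [← key] at hn
    exact ⟨n, by rw [zpow_natCast, f.injective hn]⟩
  · exact ⟨n, by rw [zpow_natCast, ← key, hn]⟩

namespace StarredMap

open Equiv Equiv.Perm

theorem glue_rot_inl_eq_inr {M N : StarredMap} {a : M.Dart} {b : N.Dart}
    (h : (M.glue N).rot (M.inl N a) = M.inr N b) : M.rot a = M.star ∧ b = N.root := by
  by_cases ha : M.rot a = M.star
  · rw [glue_rot_inl_of_eq M N ha] at h
    exact ⟨ha, (inr_injective M N h).symm⟩
  · rw [glue_rot_inl M N ha] at h
    exact absurd h (inl_ne_inr M N _ _)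

theorem glue_rot_inr_eq_inl {M N : StarredMap} {a : M.Dart} {b : N.Dart}
    (h : (M.glue N).rot (M.inr N b) = M.inl N a) : N.rot b = N.root ∧ a = M.star := by
  by_cases hb : N.rot b = N.root
  · rw [glue_rot_inr_of_eq M N hb] at h
    exact ⟨hb, (inl_injective M N h).symm⟩
  · rw [glue_rot_inr M N hb] at h
    exact absurd h.symm (inl_ne_inr M N _ _)

/-- An inseparable map inside a glued map that meets the left part lies in the left part. -/
theorem exists_eq_inl_of_isInseparable {K : RootedMap} {M N : StarredMap} (hK : K.IsInseparable)
    (f : K.Dart → (M.glue N).Dart) (hrev : ∀ d, f (K.rev d) = (M.glue N).rev (f d))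
    (hsame : ∀ a b, (M.glue N).rot.SameCycle (f a) (f b) ↔ K.rot.SameCycle a b)
    (hroot : ∃ a, f K.root = M.inl N a) (d : K.Dart) : ∃ a, f d = M.inl N a := by
  by_contra hd
  obtain ⟨w, w', hw, hw', hne⟩ := hK {d | ∃ a, f d = M.inl N a}
    (fun d ⟨a, ha⟩ => ⟨M.rev a, by rw [hrev, ha, glue_rev_inl]⟩) ⟨_, hroot⟩ ⟨d, hd⟩
  have key : ∀ w, K.Mixed {d | ∃ a, f d = M.inl N a} w →
      (M.glue N).rot.SameCycle (f w) (M.inl N M.star) := by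
    rintro w ⟨⟨a, ⟨a', ha'⟩, ha⟩, b, hb, hb'⟩
    obtain ⟨b', hb''⟩ | ⟨b', hb''⟩ := glue_dart_cases (f b)
    · exact absurd ⟨b', hb''⟩ hb
    · have h1 := (hsame _ _).2 (ha.trans hb'.symm)
      rw [ha', hb'', glue_sameCycle_inl_inr] at h1
      have h2 := (hsame _ _).2 ha.symm
      rw [ha'] at h2
      exact h2.trans (glue_sameCycle_inl_inl.2 h1.1)
  exact hne ((hsame _ _).1 ((key w hw).trans (key w' hw').symm))

/-- An inseparable map containing the root would lie in the left part, missing the darts of `N`. -/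
theorem not_iso_glue {K : RootedMap} {M N : StarredMap} (hK : K.IsInseparable) :
    ¬ RootedMap.Iso K (M.glue N).toRootedMap := by
  rintro ⟨f, hrot, hrev, hroot⟩
  obtain ⟨a, ha⟩ := exists_eq_inl_of_isInseparable hK f hrev
    (fun a b => RootedMap.sameCycle_iff_of_equiv f hrot) ⟨_, hroot⟩ (f.symm (M.inr N N.root))
  rw [f.apply_symm_apply] at ha
  exact inl_ne_inr M N _ _ ha.symm

/-- The first factor is the inseparable piece carrying the root. Applied to the isomorphism and its
inverse, this matches the first factors, hence also the remainders. -/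
theorem StarIso.of_glue {M N M' N' : StarredMap} (hM : M.IsInseparable) (hM' : M'.IsInseparable)
    (h : (M.glue N).StarIso (M'.glue N')) : M.StarIso M' ∧ N.StarIso N' := by
  obtain ⟨f, hrot, hrev, hroot, hstar⟩ := h
  have hrot' : ∀ d, f.symm ((M'.glue N').rot d) = (M.glue N).rot (f.symm d) := by
    intro d
    rw [f.symm_apply_eq, hrot, f.apply_symm_apply]
  have hrev' : ∀ d, f.symm ((M'.glue N').rev d) = (M.glue N).rev (f.symm d) := by
    intro d
    rw [f.symm_apply_eq, hrev, f.apply_symm_apply]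
  have hl : ∀ a, ∃ a', f (M.inl N a) = M'.inl N' a' :=
    exists_eq_inl_of_isInseparable hM (fun a => f (M.inl N a))
      (fun d => by rw [← glue_rev_inl, hrev])
      (fun a b => (RootedMap.sameCycle_iff_of_equiv f hrot).trans glue_sameCycle_inl_inl)
      ⟨_, hroot⟩
  have hl' : ∀ a', ∃ a, f (M.inl N a) = M'.inl N' a' := by
    intro a'
    obtain ⟨a, ha⟩ := exists_eq_inl_of_isInseparable hM' (fun a => f.symm (M'.inl N' a))
      (fun d => by rw [← glue_rev_inl, hrev'])
      (fun a b => (RootedMap.sameCycle_iff_of_equiv f.symm hrot').trans glue_sameCycle_inl_inl)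
      ⟨M.root, by rw [f.symm_apply_eq]; exact hroot.symm⟩ a'
    exact ⟨a, by rw [← ha, f.apply_symm_apply]⟩
  have hr : ∀ b, ∃ b', f (M.inr N b) = M'.inr N' b' := by
    intro b
    obtain ⟨a', ha'⟩ | h := glue_dart_cases (f (M.inr N b))
    · obtain ⟨a, ha⟩ := hl' a'
      exact absurd (f.injective (ha.trans ha'.symm)) (inl_ne_inr M N _ _)
    · exact h
  have hr' : ∀ b', ∃ b, f (M.inr N b) = M'.inr N' b' := by
    intro b'
    obtain ⟨a, ha⟩ | ⟨b, hb⟩ := glue_dart_cases (f.symm (M'.inr N' b'))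
    · obtain ⟨a', ha'⟩ := hl a
      rw [← ha, f.apply_symm_apply] at ha'
      exact absurd ha'.symm (inl_ne_inr M' N' _ _)
    · exact ⟨b, by rw [← hb, f.apply_symm_apply]⟩
  obtain ⟨g, hg⟩ := f.exists_restrict (inl_injective M N) (inl_injective M' N') hl hl'
  obtain ⟨k, hk⟩ := f.exists_restrict (inr_injective M N) (inr_injective M' N') hr hr'
  have hcross : ∀ a, M.rot a = M.star → M'.rot (g a) = M'.star ∧ k N.root = N'.root := by
    intro a ha
    have h1 := hrot (M.inl N a)
    rw [glue_rot_inl_of_eq M N ha, hk, hg] at h1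
    exact glue_rot_inl_eq_inr h1.symm
  have hcross' : ∀ b, N.rot b = N.root → N'.rot (k b) = N'.root ∧ g M.star = M'.star := by
    intro b hb
    have h1 := hrot (M.inr N b)
    rw [glue_rot_inr_of_eq M N hb, hk, hg] at h1
    exact glue_rot_inr_eq_inl h1.symm
  -- The only places where `rot` passes between the two sides lead to `M.star` and `N.root`, so both
  -- are preserved.
  have hgs : g M.star = M'.star := (hcross' (N.rot.symm N.root) (by simp)).2
  have hkr : k N.root = N'.root := (hcross (M.rot.symm M.star) (by simp)).2
  refine ⟨⟨g, fun a => ?_, fun a => ?_, ?_, hgs⟩, ⟨k, fun b => ?_, fun b => ?_, hkr, ?_⟩⟩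
  · by_cases ha : M.rot a = M.star
    · rw [ha, hgs, (hcross a ha).1]
    · have h1 := hrot (M.inl N a)
      rw [glue_rot_inl M N ha, hg, hg] at h1
      by_cases ha' : M'.rot (g a) = M'.star
      · rw [glue_rot_inl_of_eq M' N' ha'] at h1
        exact absurd h1 (inl_ne_inr M' N' _ _)
      · rw [glue_rot_inl M' N' ha'] at h1
        exact inl_injective M' N' h1
  · refine inl_injective M' N' ?_
    rw [← hg, ← glue_rev_inl, hrev, hg, glue_rev_inl]
  · exact inl_injective M' N' ((hg _).symm.trans hroot)
  · by_cases hb : N.rot b = N.root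
    · rw [hb, hkr, (hcross' b hb).1]
    · have h1 := hrot (M.inr N b)
      rw [glue_rot_inr M N hb, hk, hk] at h1
      by_cases hb' : N'.rot (k b) = N'.root
      · rw [glue_rot_inr_of_eq M' N' hb'] at h1
        exact absurd h1.symm (inl_ne_inr M' N' _ _)
      · rw [glue_rot_inr M' N' hb'] at h1
        exact inr_injective M' N' h1
  · refine inr_injective M' N' ?_
    rw [← hk, ← glue_rev_inr, hrev, hk, glue_rev_inr]
  · exact inr_injective M' N' ((hk _).symm.trans hstar)

/-- The new edge is the root edge, so it is preserved; the old root and star are the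
`rot`-successors of its two darts. -/
theorem StarIso.of_close {M M' : StarredMap} (h : M.root ≠ M.star) (h' : M'.root ≠ M'.star)
    (hf : RootedMap.Iso M.close M'.close) : M.StarIso M' := by
  obtain ⟨f, hrot, hrev, hroot⟩ := hf
  have ht : f (M.new true) = M'.new true := hroot
  have hn : f (M.new false) = M'.new false := by
    have := hrev (M.new true)
    rwa [ht] at this
  have ho : ∀ a, ∃ a', f (M.old a) = M'.old a' := by
    intro a
    obtain h1 | h1 | h1 := close_dart_cases (f (M.old a))
    · exact absurd (f.injective (h1.trans ht.symm)) (old_ne_new M _ _)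
    · exact absurd (f.injective (h1.trans hn.symm)) (old_ne_new M _ _)
    · exact h1
  have ho' : ∀ a', ∃ a, f (M.old a) = M'.old a' := by
    intro a'
    obtain h1 | h1 | ⟨a, h1⟩ := close_dart_cases (f.symm (M'.old a'))
    · rw [f.symm_apply_eq, ht] at h1
      exact absurd h1 (old_ne_new M' _ _)
    · rw [f.symm_apply_eq, hn] at h1
      exact absurd h1 (old_ne_new M' _ _)
    · exact ⟨a, by rw [← h1, f.apply_symm_apply]⟩
  obtain ⟨g, hg⟩ := f.exists_restrict (old_injective M) (old_injective M') ho ho'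
  have hgr : g M.root = M'.root := by
    have h1 := hrot (M.new false)
    rw [close_rot_new_false M h, hn, close_rot_new_false M' h', hg] at h1
    exact old_injective M' h1
  have hgs : g M.star = M'.star := by
    have h1 := hrot (M.new true)
    rw [close_rot_new_true M, ht, close_rot_new_true M', hg] at h1
    exact old_injective M' h1
  refine ⟨g, fun a => ?_, fun a => ?_, hgr, hgs⟩
  · have h1 := hrot (M.old a)
    rw [hg] at h1
    by_cases hr' : M'.rot (g a) = M'.root
    · rw [close_rot_old_of_eq_root M' hr', ← hn] at h1
      by_cases hr : M.rot a = M.root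
      · rw [hr, hr', hgr]
      · by_cases hs : M.rot a = M.star
        · rw [close_rot_old_of_eq_star M hs h] at h1
          exact absurd (new_injective M (f.injective h1)) (by simp)
        · rw [close_rot_old M hr hs] at h1
          exact absurd (f.injective h1) (old_ne_new M _ _)
    · by_cases hs' : M'.rot (g a) = M'.star
      · rw [close_rot_old_of_eq_star M' hs' h', ← ht] at h1
        by_cases hr : M.rot a = M.root
        · rw [close_rot_old_of_eq_root M hr] at h1
          exact absurd (new_injective M (f.injective h1)) (by simp)
        · by_cases hs : M.rot a = M.star
          · rw [hs, hs', hgs]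
          · rw [close_rot_old M hr hs] at h1
            exact absurd (f.injective h1) (old_ne_new M _ _)
      · rw [close_rot_old M' hr' hs'] at h1
        by_cases hr : M.rot a = M.root
        · rw [close_rot_old_of_eq_root M hr, hn] at h1
          exact absurd h1.symm (old_ne_new M' _ _)
        · by_cases hs : M.rot a = M.star
          · rw [close_rot_old_of_eq_star M hs h, ht] at h1
            exact absurd h1.symm (old_ne_new M' _ _)
          · rw [close_rot_old M hr hs, hg] at h1
            exact old_injective M' h1
  · refine old_injective M' ?_
    rw [← hg, ← close_rev_old, hrev, hg, close_rev_old]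

theorem StarIso.of_chain {M M' : StarredMap} {Ms Ms' : List StarredMap}
    (hM : ∀ N ∈ M :: Ms, N.IsInseparable) (hM' : ∀ N ∈ M' :: Ms', N.IsInseparable)
    (h : (chain M Ms).StarIso (chain M' Ms')) : List.Forall₂ StarIso (M :: Ms) (M' :: Ms') := by
  induction Ms generalizing M M' Ms' with
  | nil =>
    match Ms', h with
    | [], h => exact List.Forall₂.cons h List.Forall₂.nil
    | N' :: Ns', h => exact absurd h.iso (not_iso_glue (hM M (by simp)))
  | cons N Ns ih =>
    match Ms', hM', h with
    | [], hM', h =>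
      exact absurd (RootedMap.isoSetoid.symm h.iso) (not_iso_glue (hM' M' (by simp)))
    | N' :: Ns', hM', h =>
      obtain ⟨h1, h2⟩ := StarIso.of_glue (hM M (by simp)) (hM' M' (by simp)) h
      exact List.Forall₂.cons h1 (ih (fun K hK => hM K (List.mem_cons_of_mem _ hK))
        (fun K hK => hM' K (List.mem_cons_of_mem _ hK)) h2)

theorem not_iso_link_close (M : StarredMap) : ¬ RootedMap.Iso link M.close := by
  rintro ⟨f, -, hrev, hroot⟩
  have h : ∀ b, ∃ b', f b = M.new b' := by
    rintro (_ | _)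
    · exact ⟨false, (hrev true).trans (by rw [show f true = M.new true from hroot]; rfl)⟩
    · exact ⟨true, hroot⟩
  obtain ⟨b, hb⟩ := h (f.symm (M.old M.root))
  rw [f.apply_symm_apply] at hb
  exact old_ne_new M _ _ hb

/-- An isomorphism carries one walk to the other, and since the vertices of an arc are distinct, the
star occurs at one position only. -/
theorem HasArc.eq_of_starIso {M N : StarredMap} {i j : ℕ} (hM : M.HasArc i) (hN : N.HasArc j)
    (h : M.StarIso N) : i = j := by
  obtain ⟨f, hrot, hrev, hroot, hstar⟩ := h
  have key : ∀ n : ℕ, f ((M.next ^ n) M.root) = (N.next ^ n) N.root := by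
    intro n
    induction n with
    | zero => exact hroot
    | succ n ih =>
      rw [pow_succ', Perm.mul_apply, pow_succ', Perm.mul_apply, ← ih]
      exact (hrot _).trans (congrArg N.rot (hrev _))
  rw [hM.star_eq, hN.star_eq, key] at hstar
  obtain hij | hij := le_total i j
  · exact hN.injOn i hij j le_rfl (by rw [hstar])
  · refine hM.injOn i le_rfl j hij ?_
    rw [f.injective ((key i).trans (hstar.trans (key j).symm))]

end StarredMap

namespace LabelledTree

open StarredMap

/-- A rooted map has no star, so it says nothing directly about `l` and `l'`. They are recovered
separately: from the star in `IsProper.eq_of_starIso`, from the β(1,0) condition in `eq_of_iso`. -/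
theorem children_eq_of_iso {l l' : ℕ} {cs cs' : List LabelledTree}
    (ih : ∀ c ∈ cs, ∀ c' : LabelledTree, c'.IsProper → c.toStarredMap.StarIso c'.toStarredMap →
      c = c')
    (hcs : ∀ c ∈ cs, c.IsProper) (hcs' : ∀ c ∈ cs', c.IsProper)
    (h : RootedMap.Iso (node l cs).toMap (node l' cs').toMap) : cs = cs' := by
  rw [toMap, toMap, toStarredMap_node, toStarredMap_node] at h
  match cs, cs', ih, hcs, hcs', h with
  | [], [], _, _, _, _ => rfl
  | [], t' :: ts', _, _, _, h => exact absurd h (not_iso_link_close _)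
  | t :: ts, [], _, _, _, h =>
    exact absurd (RootedMap.isoSetoid.symm h) (not_iso_link_close _)
  | t :: ts, t' :: ts', ih, hcs, hcs', h =>
    have h1 := isBlockChain_chain t ts fun c hc => (hcs c hc).isBlock
    have h2 := isBlockChain_chain t' ts' fun c hc => (hcs' c hc).isBlock
    have h3 := StarIso.of_chain
      (by
        rw [← List.map_cons]
        simp only [List.forall_mem_map]
        exact fun c hc => (hcs c hc).isBlock.inseparable)
      (by
        rw [← List.map_cons]
        simp only [List.forall_mem_map]
        exact fun c hc => (hcs' c hc).isBlock.inseparable)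
      (StarIso.of_close (h1.arc.root_ne_star h1.pos) (h2.arc.root_ne_star h2.pos) h)
    rw [← List.map_cons, ← List.map_cons, List.forall₂_map_left_iff,
      List.forall₂_map_right_iff] at h3
    have key : ∀ us us' : List LabelledTree, (∀ u ∈ us, u ∈ t :: ts) →
        (∀ u ∈ us', u ∈ t' :: ts') →
        List.Forall₂ (fun c c' => c.toStarredMap.StarIso c'.toStarredMap) us us' → us = us' := by
      intro us us' hu hu' h4
      induction h4 with
      | nil => rfl
      | cons h5 _ ih' =>
        rw [ih _ (hu _ (by simp)) _ (hcs' _ (hu' _ (by simp))) h5,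
          ih' (fun u hm => hu u (List.mem_cons_of_mem _ hm))
            (fun u hm => hu' u (List.mem_cons_of_mem _ hm))]
    exact key _ _ (fun _ h => h) (fun _ h => h) h3

theorem IsProper.eq_of_starIso {t t' : LabelledTree} (ht : t.IsProper) (ht' : t'.IsProper)
    (h : t.toStarredMap.StarIso t'.toStarredMap) : t = t' := by
  induction t using induction_on generalizing t' with
  | _ l cs ih =>
    have hl : l = t'.label := ht.isBlock.arc.eq_of_starIso ht'.isBlock.arc h
    obtain ⟨l', cs'⟩ := t'
    have hcs := (isProper_node.1 ht).2
    rw [show l = l' from hl,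
      children_eq_of_iso (fun c hc c' hc' => ih c hc (hcs c hc) hc') hcs
        (isProper_node.1 ht').2 h.iso]

theorem eq_of_iso {t t' : LabelledTree} (ht : t.IsBeta10) (hs : t.EveryNonRootHasSibling)
    (ht' : t'.IsBeta10) (hs' : t'.EveryNonRootHasSibling)
    (h : RootedMap.Iso t.toMap t'.toMap) : t = t' := by
  obtain ⟨l, cs⟩ := t
  obtain ⟨l', cs'⟩ := t'
  have hcs := (isProper_node.1 (ht.isProper hs)).2
  obtain rfl := children_eq_of_iso
    (fun c hc c' hc' => (hcs c hc).eq_of_starIso hc') hcs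
    (isProper_node.1 (ht'.isProper hs')).2 h
  by_cases hc : cs = []
  · have h1 : l = 1 := ht.label_leaf (node l cs) (by simp [nodes_node]) hc
    have h2 : l' = 1 := ht'.label_leaf (node l' cs) (by simp [nodes_node]) hc
    rw [h1, h2]
  · have h1 : l = _ := ht.label_root hc
    have h2 : l' = _ := ht'.label_root hc
    rw [h1, h2]
    rfl

end LabelledTree

/-! ### Finiteness of the number of maps -/

namespace RootedMap

theorem card_dart_le (M : RootedMap) : Fintype.card M.Dart ≤ 2 * M.numEdges := by
  have : Finite M.Edge := Quotient.finite _
  rw [← Nat.card_eq_fintype_card, numEdges]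
  let g : M.Edge × Bool → M.Dart := fun p => if p.2 then p.1.out else M.rev p.1.out
  have hg : Function.Surjective g := by
    intro d
    have h1 : M.rev.SameCycle (M.edge d).out d :=
      Quotient.exact (s := Equiv.Perm.SameCycle.setoid M.rev) (Quotient.out_eq (M.edge d))
    have h2 : d = (M.edge d).out ∨ d = M.rev (M.edge d).out := by
      refine Equiv.Perm.SameCycle.of_equivalence (R := fun a b => b = a ∨ b = M.rev a)
        ⟨fun _ => Or.inl rfl, ?_, ?_⟩ (fun _ => Or.inr rfl) h1
      · rintro a b (rfl | rfl)
        · exact Or.inl rfl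
        · exact Or.inr (M.rev_rev a).symm
      · rintro a b c (rfl | rfl) (rfl | rfl)
        · exact Or.inl rfl
        · exact Or.inr rfl
        · exact Or.inr rfl
        · exact Or.inl (M.rev_rev a)
    obtain h2 | h2 := h2
    · exact ⟨(M.edge d, true), h2.symm⟩
    · exact ⟨(M.edge d, false), h2.symm⟩
  refine (Nat.card_le_card_of_surjective g hg).trans ?_
  rw [Nat.card_prod, Nat.card_eq_fintype_card (α := Bool), Fintype.card_bool, mul_comm]

/-- Every such map is isomorphic to one on `Fin m` with `m ≤ 2 * n`. Finiteness is needed since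
`Set.ncard` of an infinite set is 0. -/
theorem finite_setOf_numEdges_eq (n : ℕ) :
    ((Quotient.mk isoSetoid) '' {M : RootedMap | M.numEdges = n}).Finite := by
  let T := Σ m : Fin (2 * n + 1), Equiv.Perm (Fin m) ×
    {r : Equiv.Perm (Fin m) // (∀ d, r (r d) = d) ∧ ∀ d, r d ≠ d} × Fin m
  let F : T → RootedMap := fun x => ⟨Fin x.1, x.2.1, x.2.2.1.1, x.2.2.1.2.1, x.2.2.1.2.2, x.2.2.2⟩
  refine (Set.finite_range fun x : T => Quotient.mk isoSetoid (F x)).subset ?_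
  rintro _ ⟨M, rfl, rfl⟩
  let e := Fintype.equivFin M.Dart
  refine ⟨⟨⟨Fintype.card M.Dart, Nat.lt_succ_of_le M.card_dart_le⟩, e.permCongr M.rot,
    ⟨e.permCongr M.rev, fun d => ?_, fun d h => ?_⟩, e M.root⟩,
    Quotient.sound (RootedMap.isoSetoid.symm ⟨e, fun d => ?_, fun d => ?_, rfl⟩)⟩
  · simp [M.rev_rev]
  · rw [Equiv.permCongr_apply, ← Equiv.eq_symm_apply] at h
    exact M.rev_ne _ h
  · exact ((Equiv.permCongr_apply e M.rot (e d)).trans (by rw [e.symm_apply_apply])).symm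
  · exact ((Equiv.permCongr_apply e M.rev (e d)).trans (by rw [e.symm_apply_apply])).symm

end RootedMap

-- Lower bounds from the injectivity of the map of a tree

namespace LabelledTree

theorem numSiblingTrees_le (k n : ℕ) : numSiblingTrees k n ≤ RootedMap.numMultipleEdgeFree n := by
  have hfin : Finite ((Quotient.mk RootedMap.isoSetoid) ''
      {M : RootedMap | M.IsNonseparablePlanar ∧ M.IsMultipleEdgeFree ∧ M.numEdges = n}) :=
    ((RootedMap.finite_setOf_numEdges_eq n).subset (Set.image_mono fun M hM => hM.2.2)).to_subtype
  rw [RootedMap.numMultipleEdgeFree, ← Nat.card_coe_set_eq]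
  refine Nat.card_le_card_of_injective
    (fun t => ⟨Quotient.mk _ t.1.toMap, t.1.toMap, ?_, rfl⟩) ?_
  · obtain ⟨t, h1, h2, h3, rfl⟩ := t
    exact ⟨(h1.isProper h2).isNonseparablePlanar, (h1.isProper h2).isMultipleEdgeFree,
      numEdges_toMap t⟩
  · rintro ⟨t, h1, h2, h3⟩ ⟨t', h1', h2', h3'⟩ h
    exact Subtype.ext (eq_of_iso h1 h2 h1' h2'
      (Quotient.exact (s := RootedMap.isoSetoid) (congrArg Subtype.val h)))

end LabelledTree

/-! ### Generating functions of types with a size function -/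

/-- The generating function of a type by size. -/
noncomputable def sizeGF {α : Type*} (size : α → ℕ) : PowerSeries ℝ :=
  PowerSeries.mk fun n => (Nat.card {a // size a = n} : ℝ)

section SizeGF

variable {α β : Type*}

theorem sizeGF_congr {f : α → ℕ} {g : β → ℕ} (φ : β → α) (hφ : Function.Bijective φ)
    (h : ∀ b, f (φ b) = g b) : sizeGF f = sizeGF g := by
  ext n
  rw [sizeGF, sizeGF, PowerSeries.coeff_mk, PowerSeries.coeff_mk, Nat.cast_inj]
  exact (Nat.card_congr ((Equiv.ofBijective φ hφ).subtypeEquiv fun b => by simp [h])).symm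

theorem sizeGF_succ (f : α → ℕ) : sizeGF (fun a => f a + 1) = PowerSeries.X * sizeGF f := by
  ext n
  rw [sizeGF, PowerSeries.coeff_mk]
  cases n with
  | zero => simp
  | succ n => simp [sizeGF, PowerSeries.coeff_succ_X_mul]

theorem sizeGF_zero [Finite α] : sizeGF (fun _ : α => 0) = (Nat.card α : PowerSeries ℝ) := by
  ext n
  rw [sizeGF, PowerSeries.coeff_mk, ← map_natCast (PowerSeries.C (R := ℝ)), PowerSeries.coeff_C]
  cases n with
  | zero => simp [Nat.card_congr (Equiv.subtypeUnivEquiv (p := fun _ : α => True) (by simp))]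
  | succ n => simp

/-- Finite fibres are required because `Nat.card` of an infinite type is 0. -/
theorem sizeGF_sum {f : α → ℕ} {g : β → ℕ} (hf : ∀ n, Finite {a // f a = n})
    (hg : ∀ n, Finite {b // g b = n}) : sizeGF (Sum.elim f g) = sizeGF f + sizeGF g := by
  ext n
  have := hf n
  have := hg n
  rw [map_add]
  simp only [sizeGF, PowerSeries.coeff_mk]
  rw [← Nat.cast_add, ← Nat.card_sum, Nat.cast_inj]
  exact Nat.card_congr Equiv.subtypeSum

theorem sizeGF_prod {f : α → ℕ} {g : β → ℕ} (hf : ∀ n, Finite {a // f a = n})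
    (hg : ∀ n, Finite {b // g b = n}) :
    sizeGF (fun p : α × β => f p.1 + g p.2) = sizeGF f * sizeGF g := by
  ext n
  rw [PowerSeries.coeff_mul]
  simp only [sizeGF, PowerSeries.coeff_mk, ← Nat.cast_mul, ← Nat.cast_sum, Nat.cast_inj]
  rw [← Finset.sum_coe_sort]
  simp only [← Nat.card_prod]
  rw [← Nat.card_sigma]
  let φ : {p : α × β // f p.1 + g p.2 = n} →
      Σ q : Finset.HasAntidiagonal.antidiagonal n, {a // f a = q.1.1} × {b // g b = q.1.2} :=
    fun p => ⟨⟨(f p.1.1, g p.1.2), Finset.HasAntidiagonal.mem_antidiagonal.2 p.2⟩,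
      ⟨p.1.1, rfl⟩, ⟨p.1.2, rfl⟩⟩
  refine Nat.card_eq_of_bijective φ ⟨?_, ?_⟩
  · rintro ⟨⟨a, b⟩, h⟩ ⟨⟨a', b'⟩, h'⟩ hp
    have h1 : ∀ x y : Σ q : Finset.HasAntidiagonal.antidiagonal n,
        {a // f a = q.1.1} × {b // g b = q.1.2},
        x = y → x.2.1.1 = y.2.1.1 ∧ x.2.2.1 = y.2.2.1 := by
      rintro x _ rfl
      exact ⟨rfl, rfl⟩
    obtain ⟨h2, h3⟩ := h1 _ _ hp
    exact Subtype.ext (Prod.ext h2 h3)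
  · rintro ⟨⟨⟨i, j⟩, hij⟩, ⟨a, ha⟩, ⟨b, hb⟩⟩
    obtain rfl : f a = i := ha
    obtain rfl : g b = j := hb
    exact ⟨⟨(a, b), Finset.HasAntidiagonal.mem_antidiagonal.1 hij⟩, rfl⟩

theorem finite_fiber_prod {f : α → ℕ} {g : β → ℕ} (hf : ∀ n, Finite {a // f a = n})
    (hg : ∀ n, Finite {b // g b = n}) (n : ℕ) : Finite {p : α × β // f p.1 + g p.2 = n} := by
  let φ : {p : α × β // f p.1 + g p.2 = n} →
      Σ i : Fin (n + 1), Σ j : Fin (n + 1), {a // f a = i} × {b // g b = j} :=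
    fun p => ⟨⟨f p.1.1, by omega⟩, ⟨g p.1.2, by omega⟩, ⟨p.1.1, rfl⟩, ⟨p.1.2, rfl⟩⟩
  refine Finite.of_injective φ ?_
  rintro ⟨⟨a, b⟩, h⟩ ⟨⟨a', b'⟩, h'⟩ hp
  have h1 : ∀ x y : Σ i : Fin (n + 1), Σ j : Fin (n + 1), {a // f a = i} × {b // g b = j},
      x = y → x.2.2.1.1 = y.2.2.1.1 ∧ x.2.2.2.1 = y.2.2.2.1 := by
    rintro x _ rfl
    exact ⟨rfl, rfl⟩
  obtain ⟨h2, h3⟩ := h1 _ _ hp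
  exact Subtype.ext (Prod.ext h2 h3)

theorem finite_fiber_succ {f : α → ℕ} (hf : ∀ n, Finite {a // f a = n}) (n : ℕ) :
    Finite {a // f a + 1 = n} := by
  have := hf (n - 1)
  exact Finite.of_injective (fun a : {a // f a + 1 = n} =>
    (⟨a.1, by have := a.2; omega⟩ : {a // f a = n - 1})) fun a b h =>
      Subtype.ext (congrArg (fun x : {a // f a = n - 1} => x.1) h)

end SizeGF

/-! ### Counting the trees -/

namespace LabelledTree

theorem numNodes_pos (t : LabelledTree) : 0 < t.numNodes := by
  obtain ⟨l, cs⟩ := t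
  rw [numNodes_node]
  omega

theorem childSum_node (l : ℕ) (cs : List LabelledTree) :
    (node l cs).childSum = (cs.map label).sum := rfl

/-- Trees and forests are treated together: removing the root of a tree, or the first tree of a
forest, leaves a forest with fewer nodes. -/
theorem finite_setOf_label_le (k n : ℕ) :
    {t : LabelledTree | (∀ s ∈ t.nodes, s.label ≤ k) ∧ t.numNodes ≤ n}.Finite ∧
    {cs : List LabelledTree | (∀ c ∈ cs, ∀ s ∈ c.nodes, s.label ≤ k) ∧
      (cs.map numNodes).sum ≤ n}.Finite := by
  induction n with
  | zero =>
    refine ⟨Set.finite_empty.subset ?_, (Set.finite_singleton []).subset ?_⟩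
    · rintro t ⟨-, ht⟩
      exact absurd ht (not_le.2 t.numNodes_pos)
    · rintro (_ | ⟨c, cs⟩) ⟨-, h⟩
      · rfl
      · have := c.numNodes_pos
        simp only [List.map_cons, List.sum_cons] at h
        omega
  | succ n ih =>
    have h1 : {t : LabelledTree | (∀ s ∈ t.nodes, s.label ≤ k) ∧ t.numNodes ≤ n + 1}.Finite := by
      refine (Set.Finite.image2 node (Set.finite_Iic k) ih.2).subset ?_
      rintro ⟨l, cs⟩ ⟨h1, h2⟩
      rw [numNodes_node] at h2
      simp only [nodes_node, List.mem_cons, List.mem_flatMap] at h1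
      exact ⟨l, h1 _ (Or.inl rfl), cs, ⟨fun c hc s hs => h1 s (Or.inr ⟨c, hc, hs⟩), by omega⟩, rfl⟩
    refine ⟨h1, ((Set.finite_singleton []).union (Set.Finite.image2 List.cons h1 ih.2)).subset ?_⟩
    rintro (_ | ⟨c, cs⟩) ⟨h2, h3⟩
    · exact Or.inl rfl
    · have := c.numNodes_pos
      simp only [List.map_cons, List.sum_cons] at h3
      exact Or.inr ⟨c, ⟨h2 c (by simp), by omega⟩, cs,
        ⟨fun c' hc => h2 c' (List.mem_cons_of_mem _ hc), by omega⟩, rfl⟩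

/-- Proper trees whose labels are at most `k`. -/
def IsSmall (k : ℕ) (t : LabelledTree) : Prop := ∀ s ∈ t.nodes, s.IsProperNode ∧ s.label ≤ k

theorem length_le_sum_label {cs : List LabelledTree} (h : ∀ c ∈ cs, 0 < c.label) :
    cs.length ≤ (cs.map label).sum := by
  induction cs with
  | nil => simp
  | cons c cs ih =>
    have h1 := h c (by simp)
    have h2 := ih fun c' hc => h c' (List.mem_cons_of_mem _ hc)
    simp only [List.length_cons, List.map_cons, List.sum_cons]
    omega

theorem self_mem_nodes (t : LabelledTree) : t ∈ t.nodes := by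
  obtain ⟨l, cs⟩ := t
  simp [nodes_node]

theorem isSmall_node {k l : ℕ} {cs : List LabelledTree} :
    (node l cs).IsSmall k ↔ ((node l cs).IsProperNode ∧ l ≤ k) ∧ ∀ c ∈ cs, c.IsSmall k := by
  simp only [IsSmall, nodes_node, List.mem_cons, List.mem_flatMap]
  constructor
  · exact fun h => ⟨h _ (Or.inl rfl), fun c hc s hs => h s (Or.inr ⟨c, hc, hs⟩)⟩
  · rintro ⟨h1, h2⟩ s (rfl | ⟨c, hc, hs⟩)
    · exact h1
    · exact h2 c hc s hs

theorem isSmall_leaf {k : ℕ} (hk : 1 ≤ k) : (node 1 []).IsSmall k := by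
  rw [isSmall_node]
  exact ⟨⟨⟨Nat.one_pos, fun _ => rfl, fun h => absurd rfl h, by simp [children]⟩, hk⟩, by simp⟩

/-- Two children with positive labels have label sum at least 2, so `l ≤ k ≤ 2` already gives the
bound by the sum. This is why only `k ≤ 2` is so simple. -/
theorem isSmall_node_cons_cons {k l : ℕ} (hk : k ≤ 2) {a b : LabelledTree}
    {cs : List LabelledTree} : (node l (a :: b :: cs)).IsSmall k ↔
      (0 < l ∧ l ≤ k) ∧ ∀ c ∈ a :: b :: cs, c.IsSmall k := by
  rw [isSmall_node]
  refine and_congr_left fun h => ⟨fun h' => ⟨h'.1.1, h'.2⟩, fun h' => ⟨⟨h'.1, ?_, ?_, ?_⟩, h'.2⟩⟩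
  · simp [children]
  · intro _
    have := length_le_sum_label fun c hc => ((h c hc) c c.self_mem_nodes).1.1
    simp only [List.length_cons] at this
    rw [childSum_node, label]
    omega
  · simp [children]

theorem isBeta10_iff {k l : ℕ} {cs : List LabelledTree} :
    ((node l cs).IsBeta10 ∧ (node l cs).EveryNonRootHasSibling ∧ (node l cs).NonRootLabelsLE k) ↔
      ((cs = [] → l = 1) ∧ (cs ≠ [] → l = (cs.map label).sum) ∧ cs.length ≠ 1) ∧
        ∀ c ∈ cs, c.IsSmall k := by
  constructor
  · rintro ⟨h1, h2, h3⟩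
    have h4 := h1.isProper h2
    refine ⟨⟨h1.label_leaf _ (self_mem_nodes _), h1.label_root,
      (h4 _ (self_mem_nodes _)).2.2.2⟩, fun c hc s hs => ?_⟩
    refine ⟨(isProper_node.1 h4).2 c hc s hs, h3 s ?_⟩
    rw [nonRootNodes_node, List.mem_flatMap]
    exact ⟨c, hc, hs⟩
  · rintro ⟨⟨h1, h2, h3⟩, h4⟩
    have hpos : 0 < l := by
      by_cases hc : cs = []
      · rw [h1 hc]
        exact Nat.one_pos
      · rw [h2 hc]
        have := length_le_sum_label fun c hc => ((h4 c hc) c c.self_mem_nodes).1.1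
        have := List.length_pos_iff.2 hc
        omega
    have h5 : (node l cs).IsProper := by
      rw [isProper_node]
      exact ⟨⟨hpos, h1, fun hc => (h2 hc).le, h3⟩, fun c hc s hs => ((h4 c hc) s hs).1⟩
    have h6 : ∀ s ∈ (node l cs).nonRootNodes, s.IsProperNode ∧ s.label ≤ k := by
      intro s hs
      rw [nonRootNodes_node, List.mem_flatMap] at hs
      obtain ⟨c, hc, hs⟩ := hs
      exact h4 c hc s hs
    exact ⟨⟨fun s hs => (h5 s hs).1, fun s hs => (h5 s hs).2.1, h2, fun s hs => (h6 s hs).1.2.2.1⟩,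
      everyNonRootHasSibling_iff.2 fun s hs => (h5 s hs).2.2.2, fun s hs => (h6 s hs).2⟩

/-- The type of proper trees whose labels are at most `k`. -/
abbrev Small (k : ℕ) : Type := {t : LabelledTree // t.IsSmall k}

/-- The size of a forest. -/
def forestSize {k : ℕ} (ts : List (Small k)) : ℕ := (ts.map fun t => t.1.numNodes).sum

theorem finite_small (k n : ℕ) : Finite {t : Small k // t.1.numNodes = n} := by
  have := (finite_setOf_label_le k n).1.to_subtype
  exact Finite.of_injective (fun t : {t : Small k // t.1.numNodes = n} =>
    (⟨t.1.1, fun s hs => (t.1.2 s hs).2, t.2.le⟩ : {t : LabelledTree |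
      (∀ s ∈ t.nodes, s.label ≤ k) ∧ t.numNodes ≤ n})) fun a b h =>
      Subtype.ext (Subtype.ext (congrArg (fun x : {t : LabelledTree |
      (∀ s ∈ t.nodes, s.label ≤ k) ∧ t.numNodes ≤ n} => x.1) h))

theorem finite_forest (k n : ℕ) : Finite {ts : List (Small k) // forestSize ts = n} := by
  have := (finite_setOf_label_le k n).2.to_subtype
  refine Finite.of_injective (fun ts : {ts : List (Small k) // forestSize ts = n} =>
    (⟨ts.1.map Subtype.val, ?_, ?_⟩ : {cs : List LabelledTree |
      (∀ c ∈ cs, ∀ s ∈ c.nodes, s.label ≤ k) ∧ (cs.map numNodes).sum ≤ n})) fun a b h =>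
      Subtype.ext (Subtype.val_injective.list_map (congrArg (fun x : {cs : List LabelledTree |
      (∀ c ∈ cs, ∀ s ∈ c.nodes, s.label ≤ k) ∧ (cs.map numNodes).sum ≤ n} => x.1) h))
  · simp only [List.forall_mem_map]
    exact fun c _ s hs => (c.2 s hs).2
  · rw [List.map_map]
    exact ts.2.le

/-- The size of a forest with at least two trees. -/
def pairForestSize {k : ℕ} (p : Small k × Small k × List (Small k)) : ℕ :=
  p.1.1.numNodes + (p.2.1.1.numNodes + forestSize p.2.2)

theorem sizeGF_forest (k : ℕ) : sizeGF (forestSize (k := k)) =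
    1 + sizeGF (fun t : Small k => t.1.numNodes) * sizeGF (forestSize (k := k)) := by
  rw [← sizeGF_prod (finite_small k) (finite_forest k)]
  have h1 : sizeGF (fun _ : Unit => 0) = 1 := by
    rw [sizeGF_zero]
    simp
  rw [← h1, ← sizeGF_sum (fun n => inferInstance)
    (finite_fiber_prod (finite_small k) (finite_forest k))]
  refine sizeGF_congr (Sum.elim (fun _ => []) fun p => p.1 :: p.2) ⟨?_, ?_⟩ ?_
  · rintro (_ | ⟨a, l⟩) (_ | ⟨b, m⟩) h
    · rfl
    · cases h
    · cases h
    · simp only [Sum.elim_inr, List.cons.injEq] at h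
      rw [h.1, h.2]
  · rintro (_ | ⟨a, l⟩)
    · exact ⟨Sum.inl (), rfl⟩
    · exact ⟨Sum.inr (a, l), rfl⟩
  · rintro (_ | ⟨a, l⟩)
    · rfl
    · simp [forestSize]

theorem finite_pairForest (k n : ℕ) :
    Finite {p : Small k × Small k × List (Small k) // pairForestSize p = n} :=
  finite_fiber_prod (finite_small k) (finite_fiber_prod (finite_small k) (finite_forest k)) n

theorem sizeGF_pairForest (k : ℕ) : sizeGF (pairForestSize (k := k)) =
    sizeGF (fun t : Small k => t.1.numNodes) * (sizeGF (fun t : Small k => t.1.numNodes) *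
      sizeGF (forestSize (k := k))) := by
  rw [← sizeGF_prod (finite_small k) (finite_forest k),
    ← sizeGF_prod (finite_small k) (finite_fiber_prod (finite_small k) (finite_forest k))]
  rfl

theorem numNodes_node_pairForest {k : ℕ} (l : ℕ) (p : Small k × Small k × List (Small k)) :
    (node l (p.1.1 :: p.2.1.1 :: p.2.2.map Subtype.val)).numNodes = pairForestSize p + 1 := by
  rw [numNodes_node, pairForestSize, forestSize]
  simp only [List.map_cons, List.sum_cons, List.map_map]
  rfl

theorem isSmall_of_mem_pairForest {k : ℕ} (p : Small k × Small k × List (Small k)) :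
    ∀ c ∈ p.1.1 :: p.2.1.1 :: p.2.2.map Subtype.val, c.IsSmall k := by
  intro c hc
  simp only [List.mem_cons, List.mem_map] at hc
  obtain rfl | rfl | ⟨c, -, rfl⟩ := hc
  · exact p.1.2
  · exact p.2.1.2
  · exact c.2

theorem pairForest_injective {k : ℕ} {p q : Small k × Small k × List (Small k)}
    (h : p.1.1 :: p.2.1.1 :: p.2.2.map Subtype.val = q.1.1 :: q.2.1.1 :: q.2.2.map Subtype.val) :
    p = q := by
  simp only [List.cons.injEq] at h
  exact Prod.ext (Subtype.ext h.1) (Prod.ext (Subtype.ext h.2.1)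
    (Subtype.val_injective.list_map h.2.2))

theorem exists_pairForest {k : ℕ} {a b : LabelledTree} {cs : List LabelledTree}
    (h : ∀ c ∈ a :: b :: cs, c.IsSmall k) : ∃ p : Small k × Small k × List (Small k),
      p.1.1 :: p.2.1.1 :: p.2.2.map Subtype.val = a :: b :: cs := by
  refine ⟨(⟨a, h a (by simp)⟩, ⟨b, h b (by simp)⟩,
    cs.attachWith _ fun c hc => h c (by simp [hc])), ?_⟩
  simp

theorem sizeGF_leaf_sum {α : Type*} {f : α → ℕ} (hf : ∀ n, Finite {a // f a = n}) :
    sizeGF (Sum.elim (fun _ : Unit => 1) fun a => f a + 1) =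
      PowerSeries.X + PowerSeries.X * sizeGF f := by
  have h1 : sizeGF (fun _ : Unit => 1) = PowerSeries.X := by
    have h2 := sizeGF_succ (fun _ : Unit => 0)
    rw [sizeGF_zero] at h2
    simpa using h2
  rw [sizeGF_sum (fun n => inferInstance) (finite_fiber_succ hf), h1, sizeGF_succ]

/-- A small tree is a leaf or a root with at least two subtrees and an arbitrary label among `1,
..., k`, stored as an element of `Fin k` shifted by one. -/
theorem sizeGF_small {k : ℕ} (hk : 1 ≤ k) (hk' : k ≤ 2) :
    sizeGF (fun t : Small k => t.1.numNodes) =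
      PowerSeries.X + PowerSeries.X * ((k : PowerSeries ℝ) * sizeGF (pairForestSize (k := k))) := by
  have h1 : sizeGF (fun p : Fin k × (Small k × Small k × List (Small k)) =>
      0 + pairForestSize p.2) = k * sizeGF (pairForestSize (k := k)) := by
    rw [sizeGF_prod (f := fun _ : Fin k => 0) (fun n => inferInstance) (finite_pairForest k),
      sizeGF_zero, Nat.card_eq_fintype_card, Fintype.card_fin]
  have h2 := sizeGF_leaf_sum (finite_fiber_prod (f := fun _ : Fin k => 0) (fun n => inferInstance)
    (finite_pairForest k))
  rw [h1] at h2
  rw [← h2]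
  refine sizeGF_congr (Sum.elim (fun _ => ⟨node 1 [], isSmall_leaf hk⟩) fun p =>
    ⟨node (p.1 + 1) (p.2.1.1 :: p.2.2.1.1 :: p.2.2.2.map Subtype.val),
      (isSmall_node_cons_cons hk').2
        ⟨⟨Nat.succ_pos _, p.1.2⟩, isSmall_of_mem_pairForest p.2⟩⟩) ⟨?_, ?_⟩ ?_
  · rintro (_ | ⟨i, p⟩) (_ | ⟨j, q⟩) h <;> have h' := congrArg Subtype.val h
    · rfl
    · simp at h'
    · simp at h'
    · simp only [Sum.elim_inr, node.injEq] at h'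
      rw [pairForest_injective h'.2, Fin.ext (Nat.succ_injective h'.1)]
  · rintro ⟨⟨l, cs⟩, h⟩
    have h0 := (isSmall_node.1 h).1.1
    match cs, h, h0 with
    | [], h, h0 =>
      obtain rfl : l = 1 := h0.2.1 rfl
      exact ⟨Sum.inl (), rfl⟩
    | [c], h, h0 => exact absurd rfl h0.2.2.2
    | a :: b :: cs, h, h0 =>
      obtain ⟨⟨h1, h2⟩, h3⟩ := (isSmall_node_cons_cons hk').1 h
      obtain ⟨p, hp⟩ := exists_pairForest h3
      refine ⟨Sum.inr (⟨l - 1, by omega⟩, p), Subtype.ext ?_⟩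
      simp only [Sum.elim_inr, hp, node.injEq, and_true]
      omega
  · rintro (_ | ⟨i, p⟩)
    · simp [numNodes_node]
    · simp only [Sum.elim_inr, zero_add]
      exact numNodes_node_pairForest _ p

/-- No factor `k` appears, since the label of the root is forced by the children. -/
theorem siblingTreeGF_eq (k : ℕ) : siblingTreeGF k =
    PowerSeries.X + PowerSeries.X * sizeGF (pairForestSize (k := k)) := by
  have h1 : siblingTreeGF k = sizeGF (fun t : {t : LabelledTree // t.IsBeta10 ∧
      t.EveryNonRootHasSibling ∧ t.NonRootLabelsLE k} => t.1.numNodes) := by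
    ext n
    rw [siblingTreeGF, sizeGF, PowerSeries.coeff_mk, PowerSeries.coeff_mk, numSiblingTrees,
      Nat.cast_inj]
    exact Nat.card_congr ⟨fun t => ⟨⟨t.1, t.2.1, t.2.2.1, t.2.2.2.1⟩, t.2.2.2.2⟩,
      fun t => ⟨t.1.1, t.1.2.1, t.1.2.2.1, t.1.2.2.2, t.2⟩, fun _ => rfl, fun _ => rfl⟩
  rw [h1, ← sizeGF_leaf_sum (finite_pairForest k)]
  refine sizeGF_congr (Sum.elim (fun _ => ⟨node 1 [], isBeta10_iff.2 (by simp)⟩) fun p =>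
    ⟨node ((p.1.1 :: p.2.1.1 :: p.2.2.map Subtype.val).map label).sum
      (p.1.1 :: p.2.1.1 :: p.2.2.map Subtype.val),
      isBeta10_iff.2 ⟨by simp, isSmall_of_mem_pairForest p⟩⟩) ⟨?_, ?_⟩ ?_
  · rintro (_ | p) (_ | q) h <;> have h' := congrArg Subtype.val h
    · rfl
    · simp at h'
    · simp at h'
    · simp only [Sum.elim_inr] at h'
      rw [pairForest_injective (node.inj h').2]
  · rintro ⟨⟨l, cs⟩, h⟩
    obtain ⟨⟨h1, h2, h3⟩, h4⟩ := isBeta10_iff.1 h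
    match cs, h, h1, h2, h3, h4 with
    | [], h, h1, _, _, _ =>
      obtain rfl := h1 rfl
      exact ⟨Sum.inl (), rfl⟩
    | [c], h, _, _, h3, _ => exact absurd rfl h3
    | a :: b :: cs, h, _, h2, _, h4 =>
      obtain ⟨p, hp⟩ := exists_pairForest h4
      refine ⟨Sum.inr p, Subtype.ext ?_⟩
      simp only [Sum.elim_inr, hp, h2 (by simp)]
  · rintro (_ | p)
    · simp [numNodes_node]
    · exact numNodes_node_pairForest _ p

theorem siblingTreeGF_one_quadratic :
    (siblingTreeGF 1 - PowerSeries.X) * (1 - siblingTreeGF 1) =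
      PowerSeries.X * siblingTreeGF 1 ^ 2 := by
  have h1 := siblingTreeGF_eq 1
  have h2 := sizeGF_small (k := 1) le_rfl one_le_two
  have h3 := sizeGF_pairForest 1
  have h4 := sizeGF_forest 1
  rw [Nat.cast_one, one_mul, ← h1] at h2
  rw [h2] at h3 h4
  generalize siblingTreeGF 1 = B at *
  generalize sizeGF (forestSize (k := 1)) = F at *
  rw [h3] at h1
  linear_combination (1 - B) * h1 + PowerSeries.X * B ^ 2 * h4

/-- A small tree other than the leaf is a counted tree whose root label is replaced by 1 or 2; hence
the series `2 * B - X`. The forest series is then eliminated. -/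
theorem siblingTreeGF_two_quadratic :
    (siblingTreeGF 2 - PowerSeries.X) * (1 - (2 * siblingTreeGF 2 - PowerSeries.X)) =
      PowerSeries.X * (2 * siblingTreeGF 2 - PowerSeries.X) ^ 2 := by
  have h1 := siblingTreeGF_eq 2
  have h2 := sizeGF_small (k := 2) one_le_two le_rfl
  have h3 := sizeGF_pairForest 2
  have h4 := sizeGF_forest 2
  have h5 : sizeGF (fun t : Small 2 => t.1.numNodes) = 2 * siblingTreeGF 2 - PowerSeries.X := by
    rw [h2, h1]
    push_cast
    ring
  rw [h5] at h3 h4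
  rw [h3] at h1
  generalize siblingTreeGF 2 = B at *
  generalize sizeGF (forestSize (k := 2)) = F at *
  linear_combination (1 - (2 * B - PowerSeries.X)) * h1 +
    PowerSeries.X * (2 * B - PowerSeries.X) ^ 2 * h4

theorem constantCoeff_siblingTreeGF (k : ℕ) : PowerSeries.constantCoeff (siblingTreeGF k) = 0 := by
  rw [siblingTreeGF_eq]
  simp

end LabelledTree

/-! ### The coefficients of the square root -/

section SqrtCoeff

open Real

/-- The `n`-th coefficient of `√(1 - x)`. -/
noncomputable def sqrtCoeff (n : ℕ) : ℝ := (-1) ^ n * Ring.choose (1 / 2 : ℝ) n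

theorem sqrtCoeff_zero : sqrtCoeff 0 = 1 := by simp [sqrtCoeff]

theorem sqrtCoeff_succ (n : ℕ) : (n + 1) * sqrtCoeff (n + 1) = (n - 1 / 2) * sqrtCoeff n := by
  have h1 := Ring.descPochhammer_eq_factorial_smul_choose (1 / 2 : ℝ) n
  have h2 := Ring.descPochhammer_eq_factorial_smul_choose (1 / 2 : ℝ) (n + 1)
  rw [descPochhammer_succ_right, Polynomial.smeval_mul, h1, Polynomial.smeval_sub,
    Polynomial.smeval_X, Polynomial.smeval_natCast, nsmul_eq_mul, nsmul_eq_mul, nsmul_eq_mul,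
    Nat.factorial_succ] at h2
  have h3 : (n.factorial : ℝ) ≠ 0 := by exact_mod_cast n.factorial_ne_zero
  have h4 : Ring.choose (1 / 2 : ℝ) n * (1 / 2 - n) =
      (n + 1) * Ring.choose (1 / 2 : ℝ) (n + 1) := by
    refine mul_left_cancel₀ h3 ?_
    push_cast at h2
    linear_combination h2
  rw [sqrtCoeff, sqrtCoeff, pow_succ]
  linear_combination (-(-1) ^ n) * (-h4)

theorem abs_sqrtCoeff_le (n : ℕ) : (n + 1) * |sqrtCoeff n| ≤ 1 := by
  induction n with
  | zero => simp [sqrtCoeff_zero]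
  | succ n ih =>
    have h1 : (n + 1 : ℝ) * |sqrtCoeff (n + 1)| = |(n : ℝ) - 1 / 2| * |sqrtCoeff n| := by
      rw [← abs_mul, ← sqrtCoeff_succ, abs_mul, abs_of_pos (by positivity : (0 : ℝ) < n + 1)]
    have h2 : (n + 2 : ℝ) * |(n : ℝ) - 1 / 2| ≤ (n + 1) * (n + 1) := by
      have hn : (0 : ℝ) ≤ n := n.cast_nonneg
      rcases abs_cases ((n : ℝ) - 1 / 2) with ⟨h, -⟩ | ⟨h, -⟩ <;> rw [h] <;> nlinarith
    have h3 : (0 : ℝ) < n + 1 := by positivity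
    have h4 : (n + 1 : ℝ) * ((n + 2) * |sqrtCoeff (n + 1)|) ≤ (n + 1) * 1 := by
      calc (n + 1 : ℝ) * ((n + 2) * |sqrtCoeff (n + 1)|)
          = ((n + 2) * |(n : ℝ) - 1 / 2|) * |sqrtCoeff n| := by linear_combination (n + 2 : ℝ) * h1
        _ ≤ ((n + 1) * (n + 1)) * |sqrtCoeff n| := by gcongr
        _ = (n + 1) * ((n + 1) * |sqrtCoeff n|) := by ring
        _ ≤ (n + 1) * 1 := by gcongr
    have := le_of_mul_le_mul_left h4 h3
    push_cast
    linarith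

theorem abs_sqrtCoeff_le_one (n : ℕ) : |sqrtCoeff n| ≤ 1 := by
  have h := abs_sqrtCoeff_le n
  have h1 : 0 ≤ n * |sqrtCoeff n| := by positivity
  linarith

/-- Consecutive coefficients differ by `O((m + 1)⁻²)`, and `j` such steps are summed. The bound `m +
j + 1 ≤ (m + 1) * (j + 1)` then moves the denominator to the index `m + j` at the cost of `(j + 1) ^
2`. -/
theorem abs_sqrtCoeff_sub_le (m j : ℕ) :
    |sqrtCoeff m - sqrtCoeff (m + j)| ≤ 2 * (j + 1) ^ 3 / (m + j + 1) ^ 2 := by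
  have step : ∀ m : ℕ, |sqrtCoeff m - sqrtCoeff (m + 1)| ≤ 2 / (m + 1) ^ 2 := by
    intro m
    have h1 := abs_sqrtCoeff_le m
    have h2 : (0 : ℝ) < m + 1 := by positivity
    have h3 : sqrtCoeff m - sqrtCoeff (m + 1) = 3 / 2 * sqrtCoeff m / (m + 1) := by
      field_simp
      linear_combination (-2) * sqrtCoeff_succ m
    rw [h3, abs_div, abs_mul, abs_of_pos h2, abs_of_pos (by norm_num : (0 : ℝ) < 3 / 2),
      div_le_div_iff₀ h2 (by positivity)]
    nlinarith
  have key : ∀ j : ℕ, |sqrtCoeff m - sqrtCoeff (m + j)| ≤ 2 * j / (m + 1) ^ 2 := by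
    intro j
    induction j with
    | zero => simp
    | succ j ih =>
      have h1 := abs_sub_le (sqrtCoeff m) (sqrtCoeff (m + j)) (sqrtCoeff (m + (j + 1)))
      have h2 := step (m + j)
      have h3 : (2 : ℝ) / ((m + j : ℕ) + 1) ^ 2 ≤ 2 / (m + 1) ^ 2 := by
        push_cast
        gcongr
        have : (0 : ℝ) ≤ j := j.cast_nonneg
        linarith
      have h4 : (2 : ℝ) * (j + 1 : ℕ) / (m + 1) ^ 2 = 2 * j / (m + 1) ^ 2 + 2 / (m + 1) ^ 2 := by
        push_cast
        ring
      rw [h4]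
      have h5 : m + (j + 1) = m + j + 1 := by ring
      rw [h5] at h1 ⊢
      linarith
  refine (key j).trans ?_
  rw [div_le_div_iff₀ (by positivity) (by positivity)]
  have h1 : (m + j + 1 : ℝ) ≤ (m + 1) * (j + 1) := by
    have : (0 : ℝ) ≤ m * j := by positivity
    linarith
  calc (2 * j : ℝ) * (m + j + 1) ^ 2
      ≤ (2 * (j + 1) : ℝ) * ((m + 1 : ℝ) * (j + 1)) ^ 2 := by
        gcongr
        linarith
    _ = 2 * (j + 1 : ℝ) ^ 3 * (m + 1 : ℝ) ^ 2 := by ring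

/-- The quantity `-(sqrtCoeff n * (2 * n - 1))` is the central binomial coefficient over `4 ^ n`,
and its recurrence is matched by that of the Wallis products. -/
theorem sqrtCoeff_wallis (n : ℕ) : 0 < -(sqrtCoeff n * (2 * n - 1)) ∧
    (sqrtCoeff n * (2 * n - 1)) ^ 2 * (2 * n + 1) * Wallis.W n = 1 := by
  induction n with
  | zero => simp [sqrtCoeff_zero, Wallis.W]
  | succ n ih =>
    have h0 : (0 : ℝ) < 2 * n + 2 := by positivity
    have h1 : sqrtCoeff (n + 1) * (2 * (n + 1 : ℕ) - 1) =
        sqrtCoeff n * (2 * n - 1) * ((2 * n + 1) / (2 * n + 2)) := by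
      rw [← mul_div_assoc, eq_div_iff h0.ne']
      push_cast
      linear_combination 2 * (2 * n + 1 : ℝ) * sqrtCoeff_succ n
    rw [h1]
    constructor
    · rw [← neg_mul]
      exact mul_pos ih.1 (by positivity)
    · rw [Wallis.W_succ]
      push_cast
      have h2 : (2 * n + 1 : ℝ) ≠ 0 := by positivity
      have h3 : (2 * n + 3 : ℝ) ≠ 0 := by positivity
      refine Eq.trans ?_ ih.2
      field_simp
      ring

theorem abs_sqrtCoeff_add_le {n : ℕ} (hn : 1 ≤ n) :
    |sqrtCoeff n + 1 / (2 * (n * √(π * n)))| ≤ 3 / n ^ 2 := by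
  have hn' : (1 : ℝ) ≤ n := by exact_mod_cast hn
  obtain ⟨h1, h2⟩ := sqrtCoeff_wallis n
  set p := -(sqrtCoeff n * (2 * n - 1)) with hp
  set q := 1 / √(π * n) with hq
  have hs : 0 < √(π * n) := Real.sqrt_pos.2 (by positivity)
  have hs2 : √(π * n) ^ 2 = π * n := Real.sq_sqrt (by positivity)
  have hq0 : 0 < q := by positivity
  have hq2 : q ^ 2 * (π * n) = 1 := by
    rw [hq, div_pow, hs2]
    field_simp
  have h2' : p ^ 2 * (2 * n + 1) * Wallis.W n = 1 := by
    rw [hp, neg_sq]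
    exact h2
  have hW := Wallis.W_le n
  have hW' := Wallis.le_W n
  have hW0 := Wallis.W_pos n
  have hpi := Real.pi_gt_three
  have hpi4 := Real.pi_le_four
  -- The two bounds on Wallis's product around `π / 2` enclose `p ^ 2` near `1 / (π * n)`, giving `p
  -- ≤ q` and `q - p ≤ 2 / n`.
  have hp2 : 2 ≤ p ^ 2 * (2 * n + 1) * π := by
    have h3 : p ^ 2 * (2 * n + 1) * Wallis.W n ≤ p ^ 2 * (2 * n + 1) * (π / 2) := by gcongr
    linarith
  have hp3 : p ^ 2 * (2 * n + 1) ^ 2 * π ≤ 4 * n + 4 := by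
    have h3 : p ^ 2 * (2 * n + 1) * ((2 * n + 1) / (2 * n + 2) * (π / 2)) ≤
      p ^ 2 * (2 * n + 1) * Wallis.W n := by gcongr
    rw [h2'] at h3
    have h4 : p ^ 2 * (2 * n + 1) * ((2 * n + 1) / (2 * n + 2) * (π / 2)) =
      p ^ 2 * (2 * n + 1) ^ 2 * π / (4 * n + 4) := by
      field_simp
      ring
    rwa [h4, div_le_one (by positivity)] at h3
  have hpq : p ≤ q := by
    refine (sq_le_sq₀ h1.le hq0.le).1 ?_
    refine le_of_mul_le_mul_right ?_ (by positivity : 0 < (2 * n + 1) ^ 2 * (π * n : ℝ))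
    calc p ^ 2 * ((2 * n + 1 : ℝ) ^ 2 * (π * n)) = (p ^ 2 * (2 * n + 1 : ℝ) ^ 2 * π) * n := by ring
      _ ≤ (4 * n + 4 : ℝ) * n := by gcongr
      _ ≤ (2 * n + 1 : ℝ) ^ 2 := by nlinarith
      _ = q ^ 2 * ((2 * n + 1 : ℝ) ^ 2 * (π * n)) := by
        linear_combination (-(2 * n + 1 : ℝ) ^ 2) * hq2
  have hqp : (q - p) * n ≤ 2 := by
    have h3 : (q ^ 2 - p ^ 2) * n ^ 2 ≤ 1 := by
      refine le_of_mul_le_mul_right ?_ (by positivity : 0 < (2 * n + 1) * π)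
      calc (q ^ 2 - p ^ 2) * (n : ℝ) ^ 2 * ((2 * n + 1 : ℝ) * π) =
          (q ^ 2 * (π * n)) * (n * (2 * n + 1) : ℝ) - (p ^ 2 * (2 * n + 1) * π) * n ^ 2 := by ring
        _ ≤ 1 * (n * (2 * n + 1) : ℝ) - 2 * (n : ℝ) ^ 2 := by
          rw [hq2]
          gcongr
        _ ≤ 1 * ((2 * n + 1 : ℝ) * π) := by nlinarith
    have h4 : (q - p) * q ≤ q ^ 2 - p ^ 2 := by nlinarith
    have h5 : q * √(π * n) = 1 := by
      rw [hq]
      field_simp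
    have h6 : √(π * n) ≤ 2 * n := by
      rw [Real.sqrt_le_left (by positivity)]
      nlinarith
    have h7 : (q - p) * n * n ≤ 2 * n := by
      calc (q - p) * n * n = ((q - p) * q) * n ^ 2 * √(π * n) := by
            linear_combination (-(q - p) * n * n) * h5
        _ ≤ (q ^ 2 - p ^ 2) * n ^ 2 * √(π * n) := by gcongr
        _ ≤ 1 * √(π * n) := by gcongr
        _ ≤ 2 * n := by linarith
    exact le_of_mul_le_mul_right h7 (by linarith)
  have hq1 : q ≤ 1 := by
    rw [hq, div_le_one hs, Real.one_le_sqrt]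
    nlinarith
  have h2n : (0 : ℝ) < 2 * n - 1 := by linarith
  have e1 : sqrtCoeff n + 1 / (2 * (n * √(π * n))) =
      (q - p) / (2 * n - 1) - q / (2 * n * (2 * n - 1)) := by
    have e2 : sqrtCoeff n = -p / (2 * n - 1) := by
      rw [eq_div_iff h2n.ne', hp]
      ring
    have e3 : 1 / (2 * (n * √(π * n))) = q / (2 * n) := by
      rw [hq]
      field_simp
    rw [e2, e3]
    field_simp
    ring
  have b1 : (q - p) / (2 * n - 1) ≤ 2 / n ^ 2 := by
    rw [div_le_div_iff₀ h2n (by positivity)]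
    nlinarith
  have b2 : 0 ≤ (q - p) / (2 * n - 1) := div_nonneg (by linarith) h2n.le
  have b3 : q / (2 * n * (2 * n - 1)) ≤ 1 / n ^ 2 := by
    rw [div_le_div_iff₀ (by positivity) (by positivity)]
    nlinarith
  have b4 : 0 ≤ q / (2 * n * (2 * n - 1)) := by positivity
  have b5 : (3 : ℝ) / n ^ 2 = 2 / n ^ 2 + 1 / n ^ 2 := by ring
  have b6 : (0 : ℝ) ≤ 1 / n ^ 2 := by positivity
  have b7 : (0 : ℝ) ≤ 2 / n ^ 2 := by positivity
  rw [e1, b5, abs_le]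
  constructor <;> linarith

theorem hasSum_sqrtCoeff {y : ℝ} (hy : |y| < 1) :
    HasSum (fun n => sqrtCoeff n * y ^ n) (√(1 - y)) := by
  have h := (one_add_rpow_hasFPowerSeriesOnBall_zero (a := 1 / 2)).hasSum (y := -y)
    (by
      rw [Metric.mem_eball, edist_zero_right, enorm_neg, ← ofReal_norm, Real.norm_eq_abs,
        ENNReal.ofReal_lt_one]
      exact hy)
  rw [zero_add, ← sub_eq_add_neg, ← Real.sqrt_eq_rpow] at h
  refine (congrArg (HasSum · (√(1 - y))) (funext fun n => ?_)).mp h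
  rw [binomialSeries_apply, List.ofFn_const, List.prod_replicate, smul_eq_mul, neg_pow, sqrtCoeff]
  ring

end SqrtCoeff

/-! ### Transfer from a square root singularity to the coefficients -/

section Transfer

open Filter Asymptotics Finset

/-- Convolution of the coefficients of `√(1 - x)` with a rapidly decreasing sequence. -/
theorem abs_convolution_sqrtCoeff_sub_le {g : ℕ → ℝ} {G : ℝ} (hG : HasSum g G)
    (hs : Summable fun j => |g j| * (j + 1) ^ 3) (n : ℕ) :
    |∑ j ∈ range (n + 1), g j * sqrtCoeff (n - j) - G * sqrtCoeff n| ≤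
      2 * (∑' j, |g j| * (j + 1) ^ 3) / (n + 1) ^ 2 := by
  -- A common majorant: for `j ≤ n` it bounds the error of replacing `sqrtCoeff (n - j)` by
  -- `sqrtCoeff n`; for `j > n` its factor of `|g j|` is at least 1, which covers the tail missing
  -- from the finite sum.
  set d : ℕ → ℝ := fun j => 2 / (n + 1) ^ 2 * (|g j| * (j + 1) ^ 3) with hd
  have hds : Summable d := hs.mul_left _
  have hdt : ∑' j, d j = 2 * (∑' j, |g j| * (j + 1) ^ 3) / (n + 1) ^ 2 := by
    rw [hd, tsum_mul_left]
    ring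
  rw [← hdt, ← hds.sum_add_tsum_nat_add (n + 1), ← hG.tsum_eq,
    ← hG.summable.sum_add_tsum_nat_add (n + 1)]
  have e : ∑ j ∈ range (n + 1), g j * sqrtCoeff (n - j) -
      (∑ j ∈ range (n + 1), g j + ∑' j, g (j + (n + 1))) * sqrtCoeff n =
      ∑ j ∈ range (n + 1), g j * (sqrtCoeff (n - j) - sqrtCoeff n) -
        ∑' j, g (j + (n + 1)) * sqrtCoeff n := by
    rw [tsum_mul_right, add_mul, Finset.sum_mul, ← sub_sub, ← Finset.sum_sub_distrib]
    congr 1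
    exact Finset.sum_congr rfl fun j _ => by ring
  rw [e]
  refine (abs_sub _ _).trans (add_le_add ?_ ?_)
  · refine (Finset.abs_sum_le_sum_abs _ _).trans (Finset.sum_le_sum fun j hj => ?_)
    have hj' : j ≤ n := Nat.lt_succ_iff.1 (Finset.mem_range.1 hj)
    have h1 := abs_sqrtCoeff_sub_le (n - j) j
    rw [Nat.sub_add_cancel hj', Nat.cast_sub hj', sub_add_cancel] at h1
    rw [abs_mul]
    calc |g j| * |sqrtCoeff (n - j) - sqrtCoeff n|
        ≤ |g j| * (2 * ((j : ℝ) + 1) ^ 3 / ((n : ℝ) + 1) ^ 2) := by gcongr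
      _ = d j := by
        simp only [hd]
        ring
  · have hb : ∀ j, ‖g (j + (n + 1)) * sqrtCoeff n‖ ≤ d (j + (n + 1)) := by
      intro j
      rw [Real.norm_eq_abs, abs_mul]
      have h1 : (1 : ℝ) ≤ 2 / (n + 1) ^ 2 * ((j + (n + 1) : ℕ) + 1) ^ 3 := by
        rw [div_mul_eq_mul_div, le_div_iff₀ (by positivity), one_mul]
        have hj : (0 : ℝ) ≤ j := j.cast_nonneg
        have hn : (0 : ℝ) ≤ n := n.cast_nonneg
        push_cast
        calc ((n : ℝ) + 1) ^ 2 ≤ ((j : ℝ) + (n + 1) + 1) ^ 2 := by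
              gcongr
              linarith
          _ ≤ ((j : ℝ) + (n + 1) + 1) ^ 3 := by
            gcongr
            · linarith
            · norm_num
          _ ≤ 2 * ((j : ℝ) + (n + 1) + 1) ^ 3 := by
            have : 0 ≤ ((j : ℝ) + (n + 1) + 1) ^ 3 := by positivity
            linarith
      calc |g (j + (n + 1))| * |sqrtCoeff n| ≤ |g (j + (n + 1))| * 1 := by
            gcongr
            exact abs_sqrtCoeff_le_one n
        _ ≤ |g (j + (n + 1))| * (2 / (n + 1) ^ 2 * ((j + (n + 1) : ℕ) + 1) ^ 3) := by gcongr
        _ = d (j + (n + 1)) := by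
          simp only [hd]
          ring
    exact tsum_of_norm_bounded ((summable_nat_add_iff (n + 1)).2 hds).hasSum hb

/-- The formal power series of `√(1 - y x)`. -/
noncomputable def sqrtSeries (y : ℝ) : PowerSeries ℝ := PowerSeries.mk fun n => sqrtCoeff n * y ^ n

/-- It is a rescaled binomial series of exponent 1/2, and exponents add under multiplication. -/
theorem sqrtSeries_sq (y : ℝ) : sqrtSeries y ^ 2 = 1 - PowerSeries.C y * PowerSeries.X := by
  have h : sqrtSeries y =
      PowerSeries.rescale (-y) (PowerSeries.binomialSeries ℝ (1 / 2 : ℝ)) := by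
    ext n
    rw [PowerSeries.coeff_rescale, PowerSeries.binomialSeries_coeff, sqrtSeries,
      PowerSeries.coeff_mk, sqrtCoeff, neg_pow, smul_eq_mul]
    ring
  rw [h, ← map_pow, sq, ← PowerSeries.binomialSeries_add, add_halves]
  have h1 := PowerSeries.binomialSeries_nat (R := ℝ) (A := ℝ) 1
  rw [Nat.cast_one, pow_one] at h1
  rw [h1, map_add, map_one, PowerSeries.rescale_X, map_neg]
  ring

theorem constantCoeff_sqrtSeries (y : ℝ) : PowerSeries.constantCoeff (sqrtSeries y) = 1 := by
  rw [← PowerSeries.coeff_zero_eq_constantCoeff_apply, sqrtSeries, PowerSeries.coeff_mk,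
    sqrtCoeff_zero]
  simp

/-- The formal power series of `1 / (1 - z x)`. -/
noncomputable def geomSeries (z : ℝ) : PowerSeries ℝ := PowerSeries.mk fun n => z ^ n

theorem geomSeries_mul (z : ℝ) : geomSeries z * (1 - PowerSeries.C z * PowerSeries.X) = 1 := by
  ext n
  rw [mul_sub, mul_one, mul_left_comm, mul_comm _ PowerSeries.X, map_sub, PowerSeries.coeff_C_mul,
    PowerSeries.coeff_one]
  cases n with
  | zero => simp [geomSeries]
  | succ n =>
    rw [PowerSeries.coeff_succ_X_mul]
    simp [geomSeries, pow_succ']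

theorem rescale_sqrtSeries (a y : ℝ) :
    PowerSeries.rescale a (sqrtSeries y) = sqrtSeries (a * y) := by
  ext n
  rw [PowerSeries.coeff_rescale, sqrtSeries, sqrtSeries, PowerSeries.coeff_mk,
    PowerSeries.coeff_mk, mul_pow]
  ring

theorem rescale_geomSeries (a z : ℝ) :
    PowerSeries.rescale a (geomSeries z) = geomSeries (a * z) := by
  ext n
  rw [PowerSeries.coeff_rescale, geomSeries, geomSeries, PowerSeries.coeff_mk,
    PowerSeries.coeff_mk, mul_pow]

theorem abs_coeff_sqrtSeries_mul_geomSeries_le {y z r : ℝ} (hy : |y| ≤ r) (hz : |z| ≤ r) (j : ℕ) :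
    |PowerSeries.coeff j (sqrtSeries y * geomSeries z)| ≤ (j + 1) * r ^ j := by
  rw [PowerSeries.coeff_mul]
  refine (Finset.abs_sum_le_sum_abs _ _).trans ?_
  have h : ∀ p ∈ Finset.HasAntidiagonal.antidiagonal j,
      |PowerSeries.coeff p.1 (sqrtSeries y) * PowerSeries.coeff p.2 (geomSeries z)| ≤ r ^ j := by
    intro p hp
    rw [Finset.HasAntidiagonal.mem_antidiagonal] at hp
    rw [sqrtSeries, geomSeries, PowerSeries.coeff_mk, PowerSeries.coeff_mk, abs_mul, abs_mul,
      abs_pow, abs_pow, ← hp, pow_add]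
    have hr : 0 ≤ r := (abs_nonneg y).trans hy
    have h1 := abs_sqrtCoeff_le_one p.1
    calc |sqrtCoeff p.1| * |y| ^ p.1 * |z| ^ p.2 ≤ 1 * r ^ p.1 * r ^ p.2 := by gcongr
      _ = r ^ p.1 * r ^ p.2 := by ring
  refine (Finset.sum_le_card_nsmul _ _ _ h).trans ?_
  rw [Finset.Nat.card_antidiagonal, nsmul_eq_mul]
  push_cast
  exact le_rfl

theorem summable_coeff_sqrtSeries_mul_geomSeries {y z : ℝ} (hy : |y| < 1) (hz : |z| < 1) :
    Summable fun j : ℕ =>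
      |PowerSeries.coeff j (sqrtSeries y * geomSeries z)| * (j + 1 : ℝ) ^ 3 := by
  obtain ⟨r, hr, hr1⟩ := exists_between (max_lt hy hz)
  obtain ⟨hyr, hzr⟩ := max_lt_iff.1 hr
  have hr0 : 0 < r := (abs_nonneg y).trans_lt hyr
  have h1 : Summable fun j : ℕ => ((j + 1 : ℕ) : ℝ) ^ 4 * r ^ (j + 1) :=
    (summable_nat_add_iff (f := fun n : ℕ => (n : ℝ) ^ 4 * r ^ n) 1).2
      (summable_pow_mul_geometric_of_norm_lt_one 4
        (show ‖r‖ < 1 by rwa [Real.norm_eq_abs, abs_of_pos hr0]))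
  refine Summable.of_nonneg_of_le (fun j => by positivity) (fun j => ?_) (h1.mul_left r⁻¹)
  calc |PowerSeries.coeff j (sqrtSeries y * geomSeries z)| * (j + 1 : ℝ) ^ 3
      ≤ ((j + 1) * r ^ j) * (j + 1 : ℝ) ^ 3 := by
        gcongr
        exact abs_coeff_sqrtSeries_mul_geomSeries_le hyr.le hzr.le j
    _ = r⁻¹ * (((j + 1 : ℕ) : ℝ) ^ 4 * r ^ (j + 1)) := by
      push_cast
      field_simp
      ring

theorem hasSum_coeff_sqrtSeries_mul_geomSeries {y z : ℝ} (hy : |y| < 1) (hz : |z| < 1) :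
    HasSum (fun j => PowerSeries.coeff j (sqrtSeries y * geomSeries z)) (√(1 - y) * (1 - z)⁻¹) := by
  have hg := summable_coeff_sqrtSeries_mul_geomSeries hy hz
  have hs : Summable fun j => PowerSeries.coeff j (sqrtSeries y * geomSeries z) := by
    refine Summable.of_norm_bounded hg fun j => ?_
    rw [Real.norm_eq_abs]
    refine le_mul_of_one_le_right (abs_nonneg _) (one_le_pow₀ ?_)
    have : (0 : ℝ) ≤ j := j.cast_nonneg
    linarith
  have h1 := hasSum_sqrtCoeff hy
  have h2 := hasSum_geometric_of_abs_lt_one hz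
  rw [← h1.tsum_eq, ← h2.tsum_eq, tsum_mul_tsum_eq_tsum_sum_antidiagonal_of_summable_norm
    h1.summable.norm h2.summable.norm]
  have e : ∀ j, PowerSeries.coeff j (sqrtSeries y * geomSeries z) =
      ∑ p ∈ Finset.HasAntidiagonal.antidiagonal j, sqrtCoeff p.1 * y ^ p.1 * z ^ p.2 := by
    intro j
    rw [PowerSeries.coeff_mul]
    simp [sqrtSeries, geomSeries]
  simp only [e] at hs ⊢
  exact hs.hasSum

/-- Apart from a polynomial of degree at most one, `c * B` is `(R - √(1 - αx) √(1 - αyx)) / (1 -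
αzx)`. The dominant singularity is `1 / α`, where the regular factor `√(1 - αyx) / (1 - αzx)` takes
the value `√(1 - y) / (1 - z)`. -/
theorem isBigO_coeff_of_sqrtSeries {α y z c q₀ q₁ R : ℝ} (hα : 0 < α) (hy : |y| < 1) (hz : |z| < 1)
    (hc : 0 < c) {B : PowerSeries ℝ}
    (hB : (1 - PowerSeries.C (α * z) * PowerSeries.X) * (PowerSeries.C c * B -
      (PowerSeries.C q₀ + PowerSeries.C q₁ * PowerSeries.X)) =
      PowerSeries.C R - sqrtSeries α * sqrtSeries (α * y)) :
    (fun n : ℕ => PowerSeries.coeff n B -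
      √(1 - y) * (1 - z)⁻¹ / (2 * c) * (1 / (n * √(Real.pi * n))) * α ^ n) =O[atTop]
      fun n : ℕ => α ^ n / (n : ℝ) ^ 2 := by
  set G := √(1 - y) * (1 - z)⁻¹ with hG
  set K := 2 * ∑' j : ℕ, |PowerSeries.coeff j (sqrtSeries y * geomSeries z)| * (j + 1 : ℝ) ^ 3
    with hK
  have hz2 : Summable fun n : ℕ => (n : ℝ) ^ 2 * |z| ^ n :=
    summable_pow_mul_geometric_of_norm_lt_one 2 (by simpa using hz)
  set Z := ∑' n : ℕ, (n : ℝ) ^ 2 * |z| ^ n with hZ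
  refine IsBigO.of_bound (c⁻¹ * (|R| * Z + K + |G| * 3)) ?_
  -- From degree 2 on, the linear polynomial `q₀ + q₁ x` does not contribute.
  filter_upwards [eventually_ge_atTop 2] with n hn
  have hn0 : (0 : ℝ) < n := by
    have : 0 < n := by omega
    exact_mod_cast this
  have hαn : 0 < α ^ n := by positivity
  set w := ∑ j ∈ range (n + 1), PowerSeries.coeff j (sqrtSeries y * geomSeries z) *
    sqrtCoeff (n - j) with hw
  have h1 : c * PowerSeries.coeff n B = R * (α * z) ^ n - α ^ n * w := by
    have h2 : PowerSeries.C c * B - (PowerSeries.C q₀ + PowerSeries.C q₁ * PowerSeries.X) =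
        PowerSeries.C R * geomSeries (α * z) -
          PowerSeries.rescale α ((sqrtSeries y * geomSeries z) * sqrtSeries 1) := by
      rw [map_mul, map_mul, rescale_sqrtSeries, rescale_sqrtSeries, rescale_geomSeries, mul_one]
      linear_combination geomSeries (α * z) * hB - (PowerSeries.C c * B -
        (PowerSeries.C q₀ + PowerSeries.C q₁ * PowerSeries.X)) * geomSeries_mul (α * z)
    have h3 := congrArg (PowerSeries.coeff n) h2
    have h4 : PowerSeries.coeff n (PowerSeries.C q₀ + PowerSeries.C q₁ * PowerSeries.X) = 0 := by
      rw [map_add, PowerSeries.coeff_C_mul, PowerSeries.coeff_C, PowerSeries.coeff_X,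
        if_neg (by omega), if_neg (by omega), mul_zero, add_zero]
    rw [map_sub, map_sub, h4, sub_zero, PowerSeries.coeff_C_mul, PowerSeries.coeff_C_mul,
      PowerSeries.coeff_rescale, PowerSeries.coeff_mul,
      Finset.Nat.sum_antidiagonal_eq_sum_range_succ_mk] at h3
    simpa [geomSeries, hw, sqrtSeries] using h3
  have h2 : |w - G * sqrtCoeff n| ≤ K / n ^ 2 := by
    refine (abs_convolution_sqrtCoeff_sub_le (hasSum_coeff_sqrtSeries_mul_geomSeries hy hz)
      (summable_coeff_sqrtSeries_mul_geomSeries hy hz) n).trans ?_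
    rw [← hK]
    have hK0 : 0 ≤ K := by
      rw [hK]
      exact mul_nonneg zero_le_two (tsum_nonneg fun j => by positivity)
    gcongr
    linarith
  have h3 := abs_sqrtCoeff_add_le (n := n) (by omega)
  have h4 : |z| ^ n ≤ Z / n ^ 2 := by
    rw [le_div_iff₀ (by positivity), mul_comm]
    exact hz2.le_tsum n fun j _ => by positivity
  have e : PowerSeries.coeff n B - G / (2 * c) * (1 / (n * √(Real.pi * n))) * α ^ n =
      c⁻¹ * α ^ n * (R * z ^ n - (w - G * sqrtCoeff n) -
        G * (sqrtCoeff n + 1 / (2 * (n * √(Real.pi * n))))) := by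
    have h5 : PowerSeries.coeff n B = c⁻¹ * (R * (α * z) ^ n - α ^ n * w) := by
      rw [← h1]
      field_simp
    rw [h5, mul_pow]
    have h6 : √(Real.pi * n) ≠ 0 := (Real.sqrt_pos.2 (by positivity)).ne'
    field_simp
    ring
  rw [e, Real.norm_eq_abs, Real.norm_eq_abs, abs_mul, abs_of_pos (by positivity : 0 < c⁻¹ * α ^ n),
    abs_of_pos (by positivity : 0 < α ^ n / (n : ℝ) ^ 2)]
  have b1 : |R * z ^ n - (w - G * sqrtCoeff n) -
      G * (sqrtCoeff n + 1 / (2 * (n * √(Real.pi * n))))| ≤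
      |R| * (Z / n ^ 2) + K / n ^ 2 + |G| * (3 / n ^ 2) := by
    refine (abs_sub _ _).trans (add_le_add ((abs_sub _ _).trans (add_le_add ?_ h2)) ?_)
    · rw [abs_mul, abs_pow]
      gcongr
    · rw [abs_mul]
      gcongr
  calc c⁻¹ * α ^ n * _ ≤ c⁻¹ * α ^ n *
        (|R| * (Z / n ^ 2) + K / n ^ 2 + |G| * (3 / n ^ 2)) := by gcongr
    _ = c⁻¹ * (|R| * Z + K + |G| * 3) * (α ^ n / n ^ 2) := by
      field_simp

/-- Square roots with constant coefficient one are unique. -/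
theorem PowerSeries.eq_of_sq_eq_sq {S T : PowerSeries ℝ} (h : S ^ 2 = T ^ 2)
    (hS : PowerSeries.constantCoeff S = 1) (hT : PowerSeries.constantCoeff T = 1) : S = T := by
  obtain h | h := sq_eq_sq_iff_eq_or_eq_neg.1 h
  · exact h
  · rw [h, map_neg, hT] at hS
    norm_num at hS

end Transfer

-- Closed forms and asymptotics of the tree counts

namespace LabelledTree

open PowerSeries

/-- Completing the square gives the discriminant `(1 - 3x)(1 + x)`; the constant coefficient selects
the sign of the root. -/
theorem siblingTreeGF_one_eq : 2 * (1 + X) * siblingTreeGF 1 =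
    1 + X - sqrtSeries 3 * sqrtSeries (-1) := by
  have h : 1 + X - 2 * (1 + X) * siblingTreeGF 1 = sqrtSeries 3 * sqrtSeries (-1) := by
    refine PowerSeries.eq_of_sq_eq_sq ?_ ?_ ?_
    · rw [mul_pow, sqrtSeries_sq, sqrtSeries_sq, map_neg, map_one, map_ofNat]
      linear_combination (-4) * (1 + X) * siblingTreeGF_one_quadratic
    · simp [constantCoeff_siblingTreeGF]
    · simp [constantCoeff_sqrtSeries]
  rw [← h]
  ring

/-- Here the discriminant `1 - 2x - 7x²` has reciprocal roots `1 ± 2√2`. -/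
theorem siblingTreeGF_two_eq : (4 + 8 * X) * siblingTreeGF 2 =
    1 + 3 * X + 4 * X ^ 2 - sqrtSeries (1 + 2 * √2) * sqrtSeries (1 - 2 * √2) := by
  have h2 : (C √2 : PowerSeries ℝ) ^ 2 = 2 := by
    rw [← map_pow, Real.sq_sqrt zero_le_two, map_ofNat]
  have h : 1 + 3 * X + 4 * X ^ 2 - (4 + 8 * X) * siblingTreeGF 2 =
      sqrtSeries (1 + 2 * √2) * sqrtSeries (1 - 2 * √2) := by
    refine PowerSeries.eq_of_sq_eq_sq ?_ ?_ ?_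
    · rw [mul_pow, sqrtSeries_sq, sqrtSeries_sq, map_add, map_sub, map_mul, map_one, map_ofNat]
      linear_combination (-8) * (1 + 2 * X) * siblingTreeGF_two_quadratic + 4 * X ^ 2 * h2
    · simp [constantCoeff_siblingTreeGF]
    · simp [constantCoeff_sqrtSeries]
  rw [← h]
  ring

theorem sq_sqrtSeries_three_mul : (sqrtSeries 3 * sqrtSeries (-1)) ^ 2 = 1 - 2 * X - 3 * X ^ 2 := by
  rw [mul_pow, sqrtSeries_sq, sqrtSeries_sq, map_neg, map_one, map_ofNat]
  ring

theorem sq_sqrtSeries_sqrt_two_mul : (sqrtSeries (1 + 2 * √2) * sqrtSeries (1 - 2 * √2)) ^ 2 =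
    1 - 2 * X - 7 * X ^ 2 := by
  have h2 : (C √2 : PowerSeries ℝ) ^ 2 = 2 := by
    rw [← map_pow, Real.sq_sqrt zero_le_two, map_ofNat]
  rw [mul_pow, sqrtSeries_sq, sqrtSeries_sq, map_add, map_sub, map_mul, map_one, map_ofNat]
  linear_combination (-4) * X ^ 2 * h2

theorem coeff_siblingTreeGF (k n : ℕ) : coeff n (siblingTreeGF k) = (numSiblingTrees k n : ℝ) := by
  rw [siblingTreeGF, coeff_mk]

theorem sqrt_div_pi_mul_cube {a : ℝ} (ha : 0 ≤ a) {n : ℕ} :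
    √(a / (Real.pi * (n : ℝ) ^ 3)) = √a * (1 / (n * √(Real.pi * n))) := by
  rw [Real.sqrt_div ha, show Real.pi * (n : ℝ) ^ 3 = n ^ 2 * (Real.pi * n) by ring,
    Real.sqrt_mul (by positivity), Real.sqrt_sq n.cast_nonneg]
  ring

theorem numSiblingTrees_one_isBigO :
    (fun n : ℕ => (numSiblingTrees 1 n : ℝ) -
      1 / 8 * √(3 / (Real.pi * (n : ℝ) ^ 3)) * 3 ^ n)
      =O[Filter.atTop] (fun n : ℕ => (3 : ℝ) ^ n / (n : ℝ) ^ 2) := by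
  -- The factor `1 + x` occurs both under the root and in the denominator, so `y = z = -1 / 3`; it
  -- divides `1 + x`, so the remainder `R` is 0.
  have h := isBigO_coeff_of_sqrtSeries (α := 3) (y := -1 / 3) (z := -1 / 3) (c := 2) (q₀ := 1)
    (q₁ := 0) (R := 0) (B := siblingTreeGF 1) (by norm_num) (by norm_num [abs_lt])
    (by norm_num [abs_lt]) (by norm_num) (by
      rw [show (3 : ℝ) * (-1 / 3) = -1 by norm_num]
      simp only [map_neg, map_one, map_zero, map_ofNat]
      linear_combination siblingTreeGF_one_eq)
  refine h.congr_left fun n => ?_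
  rw [coeff_siblingTreeGF, sqrt_div_pi_mul_cube (by norm_num)]
  have h1 : √(1 - -1 / 3) = 2 / 3 * √3 := by
    rw [show (1 - -1 / 3 : ℝ) = (2 / 3) ^ 2 * 3 by norm_num, Real.sqrt_mul (by positivity),
      Real.sqrt_sq (by norm_num)]
  rw [h1]
  ring

theorem numSiblingTrees_two_isBigO :
    (fun n : ℕ => (numSiblingTrees 2 n : ℝ) -
      1 / (8 * √2 + 12) * √((4 + √2) / (Real.pi * (n : ℝ) ^ 3)) * (7 / (2 * √2 - 1)) ^ n)
      =O[Filter.atTop] (fun n : ℕ => (7 / (2 * √2 - 1) : ℝ) ^ n / (n : ℝ) ^ 2) := by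
  have s0 : 0 ≤ √2 := Real.sqrt_nonneg 2
  have s2 : √2 ^ 2 = 2 := Real.sq_sqrt zero_le_two
  have s1 : 1 < √2 := by
    rw [Real.lt_sqrt (by norm_num)]
    norm_num
  have hα : (7 / (2 * √2 - 1) : ℝ) = 1 + 2 * √2 := by
    rw [div_eq_iff (by linarith)]
    linear_combination (-4) * s2
  rw [hα]
  set α := 1 + 2 * √2 with hαd
  have hα0 : 0 < α := by linarith
  have hy : |(1 - 2 * √2) / α| < 1 := by
    rw [abs_div, abs_of_pos hα0, div_lt_one hα0, abs_lt]
    constructor <;> linarith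
  have hz : |-2 / α| < 1 := by
    rw [abs_div, abs_of_pos hα0, div_lt_one hα0, abs_lt]
    constructor <;> linarith
  -- The values come from the division `1 + 3x + 4x² = (1 + 2x)(1/2 + 2x) + 1/2`.
  have h := isBigO_coeff_of_sqrtSeries (α := α) (y := (1 - 2 * √2) / α) (z := -2 / α) (c := 4)
    (q₀ := 1 / 2) (q₁ := 2) (R := 1 / 2) (B := siblingTreeGF 2) hα0 hy hz (by norm_num) (by
      rw [mul_div_cancel₀ _ hα0.ne', mul_div_cancel₀ _ hα0.ne']
      have hh : (C (1 / 2 : ℝ) : PowerSeries ℝ) * 2 = 1 := by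
        rw [← map_ofNat (C (R := ℝ)) 2, ← map_mul, one_div_mul_cancel two_ne_zero, map_one]
      simp only [map_neg, map_ofNat]
      linear_combination siblingTreeGF_two_eq - (1 + X) * hh)
  have hG : √(1 - (1 - 2 * √2) / α) * (1 - -2 / α)⁻¹ / (2 * 4) =
      1 / (8 * √2 + 12) * √(4 + √2) := by
    have e1 : 1 - (1 - 2 * √2) / α = (2 / α) ^ 2 * (4 + √2) := by
      field_simp
      rw [hαd]
      linear_combination 8 * s2
    have e2 : (1 - -2 / α)⁻¹ = α / (3 + 2 * √2) := by
      rw [show 1 - -2 / α = (3 + 2 * √2) / α by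
        field_simp
        rw [hαd]
        ring, inv_div]
    rw [e1, e2, Real.sqrt_mul (by positivity), Real.sqrt_sq (by positivity)]
    field_simp
    ring
  refine h.congr_left fun n => ?_
  rw [coeff_siblingTreeGF, sqrt_div_pi_mul_cube (by linarith), hG]
  ring

end LabelledTree
theorem mainTheorem6 :
    -- the sufficient condition
    (∀ t : LabelledTree, t.IsBeta10 → t.EveryNonRootHasSibling →
      t.toMap.IsNonseparablePlanar ∧ t.toMap.numEdges = t.numNodes ∧
        t.toMap.IsMultipleEdgeFree) ∧
    -- the lower bound by the trees with labels at most one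
    ((∀ n : ℕ, LabelledTree.numSiblingTrees 1 n ≤ RootedMap.numMultipleEdgeFree n) ∧
      (∃ S : PowerSeries ℝ, PowerSeries.constantCoeff S = 1 ∧
        S ^ 2 = 1 - 2 * PowerSeries.X - 3 * PowerSeries.X ^ 2 ∧
        2 * (1 + PowerSeries.X) * LabelledTree.siblingTreeGF 1 = 1 + PowerSeries.X - S) ∧
      (fun n : ℕ => (LabelledTree.numSiblingTrees 1 n : ℝ) -
          1 / 8 * √(3 / (Real.pi * (n : ℝ) ^ 3)) * 3 ^ n)
        =O[Filter.atTop] (fun n : ℕ => (3 : ℝ) ^ n / (n : ℝ) ^ 2)) ∧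
    -- the lower bound by the trees with labels at most two
    ((∀ n : ℕ, LabelledTree.numSiblingTrees 2 n ≤ RootedMap.numMultipleEdgeFree n) ∧
      (LabelledTree.siblingTreeGF 2 = PowerSeries.X
        + LabelledTree.siblingTreeGF 2 * (LabelledTree.siblingTreeGF 2 - PowerSeries.X)
        + (LabelledTree.siblingTreeGF 2 - PowerSeries.X)
          * (LabelledTree.siblingTreeGF 2 - PowerSeries.X)
        + PowerSeries.X * (LabelledTree.siblingTreeGF 2
          + (LabelledTree.siblingTreeGF 2 - PowerSeries.X)) ^ 2) ∧
      (∃ S : PowerSeries ℝ, PowerSeries.constantCoeff S = 1 ∧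
        S ^ 2 = 1 - 2 * PowerSeries.X - 7 * PowerSeries.X ^ 2 ∧
        (4 + 8 * PowerSeries.X) * LabelledTree.siblingTreeGF 2
          = 1 + 3 * PowerSeries.X + 4 * PowerSeries.X ^ 2 - S) ∧
      (fun n : ℕ => (LabelledTree.numSiblingTrees 2 n : ℝ) -
          1 / (8 * √2 + 12) * √((4 + √2) / (Real.pi * (n : ℝ) ^ 3)) * (7 / (2 * √2 - 1)) ^ n)
        =O[Filter.atTop] (fun n : ℕ => (7 / (2 * √2 - 1) : ℝ) ^ n / (n : ℝ) ^ 2)) := by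
  refine ⟨fun t h h' => ⟨(h.isProper h').isNonseparablePlanar, LabelledTree.numEdges_toMap t,
      (h.isProper h').isMultipleEdgeFree⟩,
    ⟨LabelledTree.numSiblingTrees_le 1, ⟨sqrtSeries 3 * sqrtSeries (-1), ?_,
      LabelledTree.sq_sqrtSeries_three_mul, LabelledTree.siblingTreeGF_one_eq⟩,
      LabelledTree.numSiblingTrees_one_isBigO⟩,
    ⟨LabelledTree.numSiblingTrees_le 2, ?_,
      ⟨sqrtSeries (1 + 2 * √2) * sqrtSeries (1 - 2 * √2), ?_,
        LabelledTree.sq_sqrtSeries_sqrt_two_mul, LabelledTree.siblingTreeGF_two_eq⟩,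
      LabelledTree.numSiblingTrees_two_isBigO⟩⟩
  · rw [map_mul, constantCoeff_sqrtSeries, constantCoeff_sqrtSeries, mul_one]
  -- The functional equation is the quadratic with its products expanded.
  · linear_combination LabelledTree.siblingTreeGF_two_quadratic
  · rw [map_mul, constantCoeff_sqrtSeries, constantCoeff_sqrtSeries, mul_one]
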